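/- **Setting.** Let $V$ be a finite-dimensional complex vector space with a real form $V_{\mathbb R}$ and complex conjugation $v\mapsto\bar v$, let $W$ be a finite increasing filtration of $V$ defined over $\mathbb R$, and for each $k$ let $Q_k$ be a non-degenerate real bilinear form on $Gr^W_k=W_k/W_{k-1}$ of parity $(-1)^k$. Fix Hodge numbers $h^{p,q}$ and let $\mathcal M$ be the classifying space of all decreasing filtrations $F$ of $V$ such that $(F,W)$ is a mixed Hodge structure, graded-polarized by $Q=\{Q_k\}$, with graded Hodge numbers $h^{p,q}$. For $F\in\mathcal M$ let $V=\bigoplus I^{p,q}_{(F,W)}$ be the Deligne bigrading, $$I^{p,q}=F^p\cap W_{p+q}\cap\Bigl(\bar F^q\cap W_{p+q}+\sum_{j>0}\bar F^{q-j}\cap W_{p+q-1-j}\Bigr),$$ and let $\mathcal M_{\mathbb R}\subseteq\mathcal M$ be the set of those $F$ for which $(F,W)$ is split over $\mathbb R$, i.e. $\overline{I^{p,q}}=I^{q,p}$ for all $p,q$. Let $G_{\mathbb C}$ be the group of all $g\in GL(V)$ which stabilize $W$ and act on $Gr^W$ by complex isometries of $Q$, let $G\subseteq G_{\mathbb C}$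 be the subgroup of those which act on $Gr^W$ by real isometries of $Q$, and let $H\subseteq G$ be the subgroup of those which induce real automorphisms of $W_k/W_{k-2}$ for all $k$. Put $\mathfrak g_{\mathbb C}=Lie(G_{\mathbb C})$ and $\mathfrak h=Lie(H)$. Fix $F_o\in\mathcal M_{\mathbb R}$, let $\check{\mathcal M}=G_{\mathbb C}.F_o$, and let $\mathfrak g^{r,s}$ be the set of $\alpha\in\mathfrak g_{\mathbb C}$ with $\alpha(I^{p,q}_{(F_o,W)})\subseteq I^{p+r,q+s}_{(F_o,W)}$ for all $p,q$. Then $\mathfrak g_{\mathbb C}=\eta_+\oplus\eta_0\oplus\eta_-\oplus\Lambda$, where $$\eta_+=\bigoplus_{r\ge0,\,s<0}\mathfrak g^{r,s},\quad \eta_0=\mathfrak g^{0,0},\quad \eta_-=\bigoplus_{r<0,\,s\ge0}\mathfrak g^{r,s},\quad \Lambda=\bigoplus_{r,s<0}\mathfrak g^{r,s}.$$ Let $\mathrm L$ be the linear operator which is $+i$ on $\eta_+$, $0$ on $\eta_0$, and $-i$ on $\eta_-\oplus\Lambda$ (it preserves $\mathfrak h$). **Theorem 7.1.** Let $F_o\in\mathcal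 M_{\mathbb R}$, let $J\subseteq\mathbb R$ be an open interval, and let $\beta:J\to\mathfrak h$ be a differentiable function which satisfies the Lax equation $$\frac{d\beta}{dy}=-[\beta(y),\mathrm L\beta(y)]\qquad(y\in J).$$ Then there exist a differentiable $H$-valued function $h(y)$ on $J$, an element $\tilde N\in\mathfrak h$ and a point $\tilde F\in\check{\mathcal M}$ such that for all $y\in J$: (a) $h^{-1}(y)\dfrac{dh}{dy}=-\mathrm L\beta(y)$ and $\beta(y)=\mathrm{Ad}(h^{-1}(y))\tilde N$; (b) $h(y).F_o=e^{iy\tilde N}.\tilde F$. -/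

import Mathlib

noncomputable section

namespace MixedHodge

/-- The linear data underlying a classifying space of graded-polarized mixed Hodge structures: a
finite-dimensional complex vector space `V` with a real structure (given by complex conjugation
`conj`, whose fixed space is the real form of `V`), a finite increasing filtration `W` defined over
the reals, and, for every `k`, a non-degenerate real bilinear form `Q k` of parity `(-1) ^ k` on
`W k / W (k - 1)`.  The norm of `V` only serves to have a topology at hand. -/
structure Data (V : Type*) [NormedAddCommGroup V] [NormedSpace ℂ V] where
  /-- complex conjugation with respect to the real form -/
  conj : V →ₛₗ[starRingEnd ℂ] V
  conj_conj : ∀ v, conj (conj v) = v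
  /-- the weight filtration -/
  W : ℤ → Submodule ℂ V
  W_mono : Monotone W
  W_bot : ∃ k, W k = ⊥
  W_top : ∃ k, W k = ⊤
  W_real : ∀ k, ∀ v ∈ W k, conj v ∈ W k
  /-- the graded polarizations -/
  Q : ∀ k, LinearMap.BilinForm ℂ (W k ⧸ (W (k - 1)).submoduleOf (W k))
  Q_nondegenerate : ∀ k, (Q k).Nondegenerate
  Q_parity : ∀ k x y, Q k x y = (-1 : ℂ) ^ k * Q k y x
  Q_real : ∀ k (u v u' v' : W k), (u' : V) = conj u → (v' : V) = conj v →
    Q k (Submodule.Quotient.mk u') (Submodule.Quotient.mk v') =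
      starRingEnd ℂ (Q k (Submodule.Quotient.mk u) (Submodule.Quotient.mk v))

/-- A family of subspaces of `V` indexed by the integers (a filtration, once it is antitone). -/
abbrev Fil (V : Type*) [NormedAddCommGroup V] [NormedSpace ℂ V] := ℤ → Submodule ℂ V

/-- The filtration `g.F`, with members `g (F p)`. -/
def act {V : Type*} [NormedAddCommGroup V] [NormedSpace ℂ V] (g : V →L[ℂ] V) (F : Fil V) :
    Fil V :=
  fun p => (F p).map (g : V →ₗ[ℂ] V)

namespace Data

variable {V : Type*} [NormedAddCommGroup V] [NormedSpace ℂ V] (D : Data V)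

/-- The graded quotient `W k / W (k - 1)`. -/
abbrev Gr (k : ℤ) : Type _ := D.W k ⧸ (D.W (k - 1)).submoduleOf (D.W k)

/-- The class in `Gr k` of a vector of `W k`. -/
abbrev cls {k : ℤ} (u : D.W k) : D.Gr k := Submodule.Quotient.mk u

/-- The subspace of `Gr k` induced by a subspace `S` of `V`: the image of `S ∩ W k`. -/
def grSub (k : ℤ) (S : Submodule ℂ V) : Submodule ℂ (D.Gr k) :=
  (S.submoduleOf (D.W k)).map ((D.W (k - 1)).submoduleOf (D.W k)).mkQ

/-- The conjugate filtration of `F`. -/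
def conjFil (F : Fil V) : Fil V := fun p => (F p).map D.conj

/-- The summand `H^{p,q}` of the Hodge structure of weight `p + q` induced by `F` on
`Gr (p + q)`. -/
def hodgePart (F : Fil V) (p q : ℤ) : Submodule ℂ (D.Gr (p + q)) :=
  D.grSub (p + q) (F p) ⊓ D.grSub (p + q) (D.conjFil F q)

/-- `(F, W)` is a mixed Hodge structure: `F` is a finite decreasing filtration which induces on
every `Gr k` a pure Hodge structure of weight `k`. -/
structure IsMHS (F : Fil V) : Prop where
  antitone : Antitone F
  exhaustive : ∃ p, F p = ⊤
  separated : ∃ p, F p = ⊥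
  isCompl : ∀ k p, IsCompl (D.grSub k (F p)) (D.grSub k (D.conjFil F (k + 1 - p)))

/-- `(F, W)` is graded-polarized by `Q`: the two Hodge-Riemann bilinear relations on each `Gr k`. -/
structure IsPolarized (F : Fil V) : Prop where
  orthogonal : ∀ k p, ∀ x ∈ D.grSub k (F p), ∀ y ∈ D.grSub k (F (k + 1 - p)), D.Q k x y = 0
  positive : ∀ p q, ∀ u u' : D.W (p + q), (u' : V) = D.conj u →
    D.cls u ∈ D.hodgePart F p q → D.cls u ≠ 0 →
    ∃ r : ℝ, 0 < r ∧ Complex.I ^ (p - q) * D.Q (p + q) (D.cls u) (D.cls u') = r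

/-- The classifying space `M` of mixed Hodge structures `(F, W)` on `V` which are graded-polarized
by `Q` and have Hodge numbers `hn p q = dim H^{p,q}`. -/
def M (hn : ℤ → ℤ → ℕ) : Set (Fil V) :=
  {F | D.IsMHS F ∧ D.IsPolarized F ∧ ∀ p q, Module.finrank ℂ (D.hodgePart F p q) = hn p q}

/-- The summand `I^{p,q}` of the Deligne bigrading of `(F, W)`. -/
def I (F : Fil V) (p q : ℤ) : Submodule ℂ V :=
  F p ⊓ D.W (p + q) ⊓
    (D.conjFil F q ⊓ D.W (p + q) ⊔
      ⨆ (j : ℤ) (_ : 0 < j), D.conjFil F (q - j) ⊓ D.W (p + q - 1 - j))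

/-- The locus of those `F` in `M` for which `(F, W)` is split over the reals. -/
def MR (hn : ℤ → ℤ → ℕ) : Set (Fil V) :=
  {F | F ∈ D.M hn ∧ ∀ p q, (D.I F p q).map D.conj = D.I F q p}

/-- The complex group of all `g` in `GL(V)` which stabilize `W` and induce isometries of the forms
`Q k` on the graded quotients. -/
def GC : Set (V →L[ℂ] V)ˣ :=
  {g | (∀ k, (D.W k).map ((g : V →L[ℂ] V) : V →ₗ[ℂ] V) = D.W k) ∧
    ∀ k (u v u' v' : D.W k), (u' : V) = (g : V →L[ℂ] V) u → (v' : V) = (g : V →L[ℂ] V) v →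
      D.Q k (D.cls u') (D.cls v') = D.Q k (D.cls u) (D.cls v)}

/-- The group `G` of all `g` in `GL(V)` which stabilize `W` and induce real isometries of the forms
`Q k` on the graded quotients. -/
def G : Set (V →L[ℂ] V)ˣ :=
  {g | g ∈ D.GC ∧ ∀ k, ∀ v ∈ D.W k,
    D.conj ((g : V →L[ℂ] V) v) - (g : V →L[ℂ] V) (D.conj v) ∈ D.W (k - 1)}

/-- The group `H` of those `g` in `G` which induce real automorphisms of all the quotients
`W k / W (k - 2)`. -/
def H : Set (V →L[ℂ] V)ˣ :=
  {g | g ∈ D.G ∧ ∀ k, ∀ v ∈ D.W k,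
    D.conj ((g : V →L[ℂ] V) v) - (g : V →L[ℂ] V) (D.conj v) ∈ D.W (k - 2)}

/-- The orbit of `F` under the complex group; for `F` in `M` this is the compact dual of `M`. -/
def Mcheck (F : Fil V) : Set (Fil V) := {F' | ∃ g ∈ D.GC, F' = act (g : V →L[ℂ] V) F}

/-- The Lie algebra of the complex group: the endomorphisms which preserve `W` and induce
infinitesimal isometries of the forms `Q k`. -/
def lieGC : Submodule ℂ (V →L[ℂ] V) where
  carrier := {a | (∀ k, ∀ v ∈ D.W k, a v ∈ D.W k) ∧
    ∀ k (u v u' v' : D.W k), (u' : V) = a u → (v' : V) = a v →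
      D.Q k (D.cls u') (D.cls v) + D.Q k (D.cls u) (D.cls v') = 0}
  zero_mem' := by
    refine ⟨fun k v _ => by simp, fun k u v u' v' hu hv => ?_⟩
    have h1 : u' = 0 := Subtype.ext (by simpa using hu)
    have h2 : v' = 0 := Subtype.ext (by simpa using hv)
    subst h1 h2
    simp [cls]
  add_mem' := by
    rintro a b ⟨ha, ha'⟩ ⟨hb, hb'⟩
    refine ⟨fun k v hv => (D.W k).add_mem (ha k v hv) (hb k v hv), fun k u v u' v' hu hv => ?_⟩
    have h1 : u' = ⟨a u, ha k u u.2⟩ + ⟨b u, hb k u u.2⟩ := Subtype.ext (by simpa using hu)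
    have h2 : v' = ⟨a v, ha k v v.2⟩ + ⟨b v, hb k v v.2⟩ := Subtype.ext (by simpa using hv)
    have e1 := ha' k u v ⟨a u, ha k u u.2⟩ ⟨a v, ha k v v.2⟩ rfl rfl
    have e2 := hb' k u v ⟨b u, hb k u u.2⟩ ⟨b v, hb k v v.2⟩ rfl rfl
    subst h1 h2
    simp only [cls, Submodule.Quotient.mk_add, map_add, LinearMap.add_apply] at e1 e2 ⊢
    linear_combination e1 + e2
  smul_mem' := by
    rintro c a ⟨ha, ha'⟩
    refine ⟨fun k v hv => (D.W k).smul_mem c (ha k v hv), fun k u v u' v' hu hv => ?_⟩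
    have h1 : u' = c • ⟨a u, ha k u u.2⟩ := Subtype.ext (by simpa using hu)
    have h2 : v' = c • ⟨a v, ha k v v.2⟩ := Subtype.ext (by simpa using hv)
    have e1 := ha' k u v ⟨a u, ha k u u.2⟩ ⟨a v, ha k v v.2⟩ rfl rfl
    subst h1 h2
    simp only [cls, Submodule.Quotient.mk_smul, map_smul, LinearMap.smul_apply, smul_eq_mul]
      at e1 ⊢
    linear_combination c * e1

/-- The Lie algebra of `H`: those members of the Lie algebra of the complex group which induce real
endomorphisms of all the quotients `W k / W (k - 2)`. -/
def lieH : Submodule ℝ (V →L[ℂ] V) where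
  carrier := {a | a ∈ D.lieGC ∧ ∀ k, ∀ v ∈ D.W k, D.conj (a v) - a (D.conj v) ∈ D.W (k - 2)}
  zero_mem' := ⟨D.lieGC.zero_mem, fun k v _ => by simp⟩
  add_mem' := by
    rintro a b ⟨ha, ha'⟩ ⟨hb, hb'⟩
    refine ⟨D.lieGC.add_mem ha hb, fun k v hv => ?_⟩
    have := (D.W (k - 2)).add_mem (ha' k v hv) (hb' k v hv)
    simpa [add_sub_add_comm] using this
  smul_mem' := by
    rintro c a ⟨ha, ha'⟩
    refine ⟨D.lieGC.smul_mem (c : ℂ) ha, fun k v hv => ?_⟩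
    have := (D.W (k - 2)).smul_mem (c : ℂ) (ha' k v hv)
    have e : D.conj ((c • a) v) - (c • a) (D.conj v) =
        (c : ℂ) • (D.conj (a v) - a (D.conj v)) := by
      change D.conj ((c : ℂ) • a v) - (c : ℂ) • a (D.conj v) = _
      rw [LinearMap.map_smulₛₗ, Complex.conj_ofReal, smul_sub]
    rwa [e]

section LieAlgebras

/-! `lieGC` and `lieH` are the Lie algebras of `GC` and `H` in the sense of one-parameter groups. -/

variable [FiniteDimensional ℂ V]

theorem exp_mem_of_pow_mem (S : Submodule ℝ (V →L[ℂ] V)) (a : V →L[ℂ] V) (h : ∀ n : ℕ, a ^ n ∈ S)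
    (t : ℝ) : NormedSpace.exp (t • a) ∈ S := by
  have : FiniteDimensional ℝ (V →L[ℂ] V) := FiniteDimensional.complexToReal _
  have : CompleteSpace (V →L[ℂ] V) := FiniteDimensional.complete ℂ _
  have hc : IsClosed (S : Set (V →L[ℂ] V)) := S.closed_of_finiteDimensional
  have hs := NormedSpace.exp_series_hasSum_exp' (𝕂 := ℝ) (t • a)
  refine hc.mem_of_tendsto hs (Filter.Eventually.of_forall fun s => ?_)
  refine S.sum_mem fun n _ => S.smul_mem _ ?_
  rw [smul_pow]
  exact S.smul_mem _ (h n)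

theorem mem_of_exp_mem (S : Submodule ℝ (V →L[ℂ] V)) (a : V →L[ℂ] V)
    (h : ∀ t : ℝ, NormedSpace.exp (t • a) ∈ S) : a ∈ S := by
  have : FiniteDimensional ℝ (V →L[ℂ] V) := FiniteDimensional.complexToReal _
  have : CompleteSpace (V →L[ℂ] V) := FiniteDimensional.complete ℂ _
  have hc : IsClosed (S : Set (V →L[ℂ] V)) := S.closed_of_finiteDimensional
  have hd := hasDerivAt_exp_smul_const (𝕂 := ℝ) a (0 : ℝ)
  rw [hasDerivAt_iff_tendsto_slope] at hd
  simp at hd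
  refine hc.mem_of_tendsto hd (Filter.Eventually.of_forall fun s => ?_)
  simp only [slope, vsub_eq_sub]
  exact S.smul_mem _ (S.sub_mem (h s) (by simpa using h 0))

/-- The operators which map `P` to `Q`. -/
def stab (P Q : Submodule ℂ V) : Submodule ℝ (V →L[ℂ] V) where
  carrier := {b | ∀ v ∈ P, b v ∈ Q}
  zero_mem' := fun v _ => by simp
  add_mem' := fun ha hb v hv => Q.add_mem (ha v hv) (hb v hv)
  smul_mem' := fun c a ha v hv => Q.smul_mem (c : ℂ) (ha v hv)

/-- The operators which commute with the conjugation on `P` modulo `Q`. -/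
def real (P Q : Submodule ℂ V) : Submodule ℝ (V →L[ℂ] V) where
  carrier := {b | ∀ v ∈ P, D.conj (b v) - b (D.conj v) ∈ Q}
  zero_mem' := fun v _ => by simp
  add_mem' := fun {a b} ha hb v hv => by
    simpa [add_sub_add_comm] using Q.add_mem (ha v hv) (hb v hv)
  smul_mem' := fun c a ha v hv => by
    have e : D.conj ((c • a) v) - (c • a) (D.conj v) =
        (c : ℂ) • (D.conj (a v) - a (D.conj v)) := by
      change D.conj ((c : ℂ) • a v) - (c : ℂ) • a (D.conj v) = _
      rw [LinearMap.map_smulₛₗ, Complex.conj_ofReal, smul_sub]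
    rw [e]; exact Q.smul_mem (c : ℂ) (ha v hv)

theorem exists_form (k : ℤ) : ∃ B : V →L[ℂ] V →L[ℂ] ℂ, ∀ u v : D.W k,
    B u v = D.Q k (D.cls u) (D.cls v) := by
  obtain ⟨P, hP⟩ := (D.W k).subtype.exists_leftInverse_of_injective (by simp)
  have hP' : ∀ u : D.W k, P u = u := fun u => LinearMap.congr_fun hP u
  let q := ((D.W (k - 1)).submoduleOf (D.W k)).mkQ ∘ₗ P
  refine ⟨((D.Q k).compl₁₂ q q).toContinuousBilinearMap, fun u v => ?_⟩
  simp [q, hP', cls]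

theorem hasDerivAt_exp_apply (a : V →L[ℂ] V) (t : ℝ) (u : V) :
    HasDerivAt (fun t : ℝ => (NormedSpace.exp (t • a) : V →L[ℂ] V) u)
      (a ((NormedSpace.exp (t • a) : V →L[ℂ] V) u)) t := by
  have : CompleteSpace (V →L[ℂ] V) := FiniteDimensional.complete ℂ _
  have h := hasDerivAt_exp_smul_const' (𝕂 := ℝ) a t
  exact ((ContinuousLinearMap.apply ℂ V u).restrictScalars ℝ).hasFDerivAt.comp_hasDerivAt t h

theorem hasDerivAt_form (B : V →L[ℂ] V →L[ℂ] ℂ) (a : V →L[ℂ] V) (t : ℝ) (u v : V) :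
    HasDerivAt (fun t : ℝ => B ((NormedSpace.exp (t • a) : V →L[ℂ] V) u)
        ((NormedSpace.exp (t • a) : V →L[ℂ] V) v))
      (B ((NormedSpace.exp (t • a) : V →L[ℂ] V) u) (a ((NormedSpace.exp (t • a) : V →L[ℂ] V) v)) +
       B (a ((NormedSpace.exp (t • a) : V →L[ℂ] V) u)) ((NormedSpace.exp (t • a) : V →L[ℂ] V) v))
      t :=
  (B.bilinearRestrictScalars ℝ).hasDerivAt_of_bilinear (fun _ => hasDerivAt_exp_apply a t u)
    (fun _ => hasDerivAt_exp_apply a t v)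

/-- `lieGC` is the Lie algebra of the linear group `GC`. -/
theorem mem_lieGC_iff_exp (a : V →L[ℂ] V) :
    a ∈ D.lieGC ↔ ∀ t : ℝ, ∃ g ∈ D.GC, (g : V →L[ℂ] V) = NormedSpace.exp (t • a) := by
  have : CompleteSpace (V →L[ℂ] V) := FiniteDimensional.complete ℂ _
  constructor
  · rintro ⟨ha, ha'⟩ t
    have hW : ∀ t : ℝ, ∀ k, ∀ v ∈ D.W k, (NormedSpace.exp (t • a) : V →L[ℂ] V) v ∈ D.W k := by
      intro t k
      refine exp_mem_of_pow_mem (stab (D.W k) (D.W k)) a (fun n => ?_) t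
      induction n with
      | zero => exact fun v hv => by simpa using hv
      | succ n ih =>
        intro v hv
        rw [pow_succ']
        exact ha k _ (ih v hv)
    have he : ∀ t : ℝ, (NormedSpace.exp (t • a) : V →L[ℂ] V) * NormedSpace.exp ((-t) • a) = 1 := by
      intro t
      let : NormedAlgebra ℚ (V →L[ℂ] V) := NormedAlgebra.restrictScalars ℚ ℂ _
      rw [← NormedSpace.exp_add_of_commute (((Commute.refl a).smul_left t).smul_right (-t))]
      simp
    let g : (V →L[ℂ] V)ˣ := ⟨NormedSpace.exp (t • a), NormedSpace.exp ((-t) • a), he t, by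
      simpa using he (-t)⟩
    refine ⟨g, ⟨fun k => ?_, ?_⟩, rfl⟩
    · refine le_antisymm ?_ fun v hv => ⟨_, hW (-t) k v hv, ?_⟩
      · rintro _ ⟨v, hv, rfl⟩
        exact hW t k v hv
      · exact congrArg (fun f : V →L[ℂ] V => f v) (he t)
    · intro k u v u' v' hu hv
      obtain ⟨B, hB⟩ := D.exists_form k
      have hc := is_const_of_deriv_eq_zero (𝕜 := ℝ)
        (fun t => (hasDerivAt_form B a t u v).differentiableAt)
        (fun t => by
          rw [(hasDerivAt_form B a t u v).deriv]
          have := ha' k ⟨_, hW t k u u.2⟩ ⟨_, hW t k v v.2⟩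
            ⟨_, ha k _ (hW t k u u.2)⟩ ⟨_, ha k _ (hW t k v v.2)⟩ rfl rfl
          rw [← hB, ← hB] at this
          rw [add_comm]; exact this) t 0
      rw [← hB, ← hB, hu, hv]
      simpa using hc
  · intro h
    have hW : ∀ t : ℝ, ∀ k, ∀ v ∈ D.W k, (NormedSpace.exp (t • a) : V →L[ℂ] V) v ∈ D.W k := by
      intro t k v hv
      obtain ⟨g, hg, e⟩ := h t
      rw [← e, ← hg.1 k]; exact ⟨v, hv, rfl⟩
    refine ⟨fun k => mem_of_exp_mem (stab (D.W k) (D.W k)) a (fun t => hW t k), ?_⟩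
    intro k u v u' v' hu hv
    obtain ⟨B, hB⟩ := D.exists_form k
    have h1 := hasDerivAt_form B a 0 u v
    have h2 : (fun t : ℝ => B ((NormedSpace.exp (t • a) : V →L[ℂ] V) u)
        ((NormedSpace.exp (t • a) : V →L[ℂ] V) v)) = fun _ => B u v := by
      funext t
      obtain ⟨g, hg, e⟩ := h t
      have := hg.2 k u v ⟨_, hW t k u u.2⟩ ⟨_, hW t k v v.2⟩ (by rw [e]) (by rw [e])
      rwa [← hB, ← hB] at this
    rw [h2] at h1
    have h3 := h1.unique (hasDerivAt_const _ _)
    rw [← hB, ← hB, hu, hv, add_comm]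
    simpa using h3

/-- `lieH` is the Lie algebra of the linear group `H`. -/
theorem mem_lieH_iff_exp (a : V →L[ℂ] V) :
    a ∈ D.lieH ↔ ∀ t : ℝ, ∃ g ∈ D.H, (g : V →L[ℂ] V) = NormedSpace.exp (t • a) := by
  constructor
  · rintro ⟨ha, ha'⟩ t
    obtain ⟨g, hg, e⟩ := (D.mem_lieGC_iff_exp a).1 ha t
    have h2 : ∀ k, ∀ v ∈ D.W k,
        D.conj ((g : V →L[ℂ] V) v) - (g : V →L[ℂ] V) (D.conj v) ∈ D.W (k - 2) := by
      intro k
      rw [e]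
      refine exp_mem_of_pow_mem (D.real (D.W k) (D.W (k - 2))) a (fun n => ?_) t
      suffices h : (∀ v ∈ D.W k, (a ^ n) v ∈ D.W k) ∧ a ^ n ∈ D.real (D.W k) (D.W (k - 2)) from h.2
      induction n with
      | zero => exact ⟨fun v hv => by simpa using hv, fun v hv => by simp⟩
      | succ n ih =>
        refine ⟨fun v hv => by rw [pow_succ']; exact ha.1 k _ (ih.1 v hv), fun v hv => ?_⟩
        have h1 := ha' k _ (ih.1 v hv)
        have h2 := ha.1 (k - 2) _ (ih.2 v hv)
        have := (D.W (k - 2)).add_mem h1 h2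
        rw [pow_succ']
        simpa using this
    exact ⟨g, ⟨⟨hg, fun k v hv => D.W_mono (by lia) (h2 k v hv)⟩, h2⟩, e⟩
  · intro h
    refine ⟨(D.mem_lieGC_iff_exp a).2 fun t => ?_, fun k => ?_⟩
    · obtain ⟨g, hg, e⟩ := h t
      exact ⟨g, hg.1.1, e⟩
    · refine mem_of_exp_mem (D.real (D.W k) (D.W (k - 2))) a fun t => ?_
      obtain ⟨g, hg, e⟩ := h t
      rw [← e]
      exact hg.2 k

end LieAlgebras

/-- The summand of type `(r, s)` of the bigrading which `(F, W)` induces on the Lie algebra of the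
complex group: the elements which map every `I^{p,q}` to `I^{p+r,q+s}`. -/
def g (F : Fil V) (r s : ℤ) : Submodule ℂ (V →L[ℂ] V) where
  carrier := {a | a ∈ D.lieGC ∧ ∀ p q, ∀ v ∈ D.I F p q, a v ∈ D.I F (p + r) (q + s)}
  zero_mem' := ⟨D.lieGC.zero_mem, fun p q v _ => by simp⟩
  add_mem' := by
    rintro a b ⟨ha, ha'⟩ ⟨hb, hb'⟩
    exact ⟨D.lieGC.add_mem ha hb, fun p q v hv =>
      (D.I F (p + r) (q + s)).add_mem (ha' p q v hv) (hb' p q v hv)⟩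
  smul_mem' := by
    rintro c a ⟨ha, ha'⟩
    exact ⟨D.lieGC.smul_mem c ha, fun p q v hv =>
      (D.I F (p + r) (q + s)).smul_mem c (ha' p q v hv)⟩

/-- `η₊`: the sum of the summands of type `(r, s)` with `r ≥ 0` and `s < 0`. -/
def etaPlus (F : Fil V) : Submodule ℂ (V →L[ℂ] V) :=
  ⨆ (r : ℤ) (s : ℤ) (_ : 0 ≤ r ∧ s < 0), D.g F r s

/-- `η₀`: the summand of type `(0, 0)`. -/
def etaZero (F : Fil V) : Submodule ℂ (V →L[ℂ] V) := D.g F 0 0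

/-- `η₋`: the sum of the summands of type `(r, s)` with `r < 0` and `s ≥ 0`. -/
def etaMinus (F : Fil V) : Submodule ℂ (V →L[ℂ] V) :=
  ⨆ (r : ℤ) (s : ℤ) (_ : r < 0 ∧ 0 ≤ s), D.g F r s

/-- `Λ`: the sum of the summands of type `(r, s)` with `r < 0` and `s < 0`. -/
def Lam (F : Fil V) : Submodule ℂ (V →L[ℂ] V) :=
  ⨆ (r : ℤ) (s : ℤ) (_ : r < 0 ∧ s < 0), D.g F r s

/-- `t = (a₊, a₀, a₋)` is the triple of components of `a` with respect to the decomposition of the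
Lie algebra of the complex group as the direct sum of `η₊`, `η₀` and `η₋ ⊕ Λ`. -/
def IsComponents (F : Fil V) (a : V →L[ℂ] V)
    (t : (V →L[ℂ] V) × (V →L[ℂ] V) × (V →L[ℂ] V)) : Prop :=
  t.1 ∈ D.etaPlus F ∧ t.2.1 ∈ D.etaZero F ∧ t.2.2 ∈ D.etaMinus F ⊔ D.Lam F ∧
    a = t.1 + t.2.1 + t.2.2

open Classical in
/-- The operator `L` on the Lie algebra of the complex group: `+i` on `η₊`, `0` on `η₀` and `-i` on
`η₋ ⊕ Λ`, that is, `L a = i a₊ - i a₋` in terms of the components of `a`.  (When `(F, W)` is a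
graded-polarized mixed Hodge structure, every member of the Lie algebra has exactly one triple of
components.  The value outside of the Lie algebra is irrelevant.) -/
def L (F : Fil V) (a : V →L[ℂ] V) : V →L[ℂ] V :=
  if h : ∃ t, D.IsComponents F a t then
    Complex.I • h.choose.1 - Complex.I • h.choose.2.2
  else 0

end Data

end MixedHodge

end

/-! Condition (a) is a linear equation for h. Solve u' = (Lβ)u with u(y₀) = 1 and put h = u⁻¹, so
that h' = -h Lβ. The Lax equation then says exactly that hβh⁻¹ has derivative zero, so it is the
constant N = β(y₀).

For (b), Lβ + iβ acts on the components of β by 2i on η₊, i on η₀ and 0 on η₋ ⊕ Λ. It therefore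
preserves F₀ (`multiplier_mem_F`), and so does the solution x of x' = (Lβ + iβ)x with x(y₀) = 1. The
terms with Lβ cancel in (hx)' = h(iβ)x = iN(hx), whence hx = exp(i(y - y₀)N). Applying both sides to
F₀ = x.F₀ gives (b) with F̃ = exp(-iy₀N).F₀.

Both equations are solved inside the subalgebra to which the solution should belong
(`Subalgebra.exists_fundamental_solution`). Isometry is not a linear condition; for u it follows by
differentiating the form along the flow (`inv_fundamental_solution_mem_H`).

The Hodge theory enters through L. `IsSplit.exists_isBigrading` provides the projections to the
I^{p,q}, and L becomes a multiplier by type (`L_eq_multiplier`), hence linear and continuous. It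
preserves the complex Lie algebra because the polarizations pair only conjugate types
(`multiplier_single_mem_lieGC`). It preserves the Lie algebra of H because its symbol is compatible
with conjugation in weights 0 and -1 (`multiplier_signL_mem_lieH`). This fails at type (-1,-1),
which is why H asks for reality only modulo W_{k-2}. -/

/-! ### Linear differential equations on intervals. -/

section LinearODE

open Set NNReal

variable {E : Type*} [NormedAddCommGroup E] [NormedSpace ℝ E]

/-- The radial retraction onto the closed ball of radius `R`. -/
noncomputable def radialRetraction (R : ℝ) (x : E) : E := (R / max R ‖x‖) • x

theorem radialRetraction_of_norm_le {R : ℝ} (hR : 0 < R) {x : E} (hx : ‖x‖ ≤ R) :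
    radialRetraction R x = x := by
  rw [radialRetraction, max_eq_left hx, div_self hR.ne', one_smul]

theorem norm_radialRetraction_eq {R : ℝ} (hR : 0 < R) (x : E) :
    ‖radialRetraction R x‖ = R / max R ‖x‖ * ‖x‖ := by
  have : 0 < max R ‖x‖ := lt_max_of_lt_left hR
  rw [radialRetraction, norm_smul, Real.norm_of_nonneg (by positivity)]

theorem norm_radialRetraction_le {R : ℝ} (hR : 0 < R) (x : E) : ‖radialRetraction R x‖ ≤ R := by
  have h : 0 < max R ‖x‖ := lt_max_of_lt_left hR
  rw [norm_radialRetraction_eq hR, div_mul_eq_mul_div, div_le_iff₀ h]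
  gcongr
  exact le_max_right _ _

theorem norm_radialRetraction_le_norm {R : ℝ} (hR : 0 < R) (x : E) :
    ‖radialRetraction R x‖ ≤ ‖x‖ := by
  have h : 0 < max R ‖x‖ := lt_max_of_lt_left hR
  rw [norm_radialRetraction_eq hR]
  exact mul_le_of_le_one_left (norm_nonneg _) ((div_le_one h).2 (le_max_left _ _))

/-- The difference splits into a term with the scaling factor frozen at x and a term for the change
of the factor. Each is at most ‖x - y‖, which gives the constant 2 in any norm. -/
theorem lipschitzWith_radialRetraction {R : ℝ} (hR : 0 < R) :
    LipschitzWith 2 (radialRetraction R : E → E) := by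
  refine LipschitzWith.of_dist_le_mul fun x y => ?_
  rw [dist_eq_norm, dist_eq_norm]
  set a := max R ‖x‖ with ha
  set b := max R ‖y‖ with hb
  have ha0 : 0 < a := lt_max_of_lt_left hR
  have hb0 : 0 < b := lt_max_of_lt_left hR
  have hab : |b - a| ≤ ‖x - y‖ := by
    have h1 := abs_max_sub_max_le_max R ‖y‖ R ‖x‖
    rw [sub_self, abs_zero, max_eq_right (a := (0 : ℝ)) (abs_nonneg _)] at h1
    exact h1.trans ((abs_norm_sub_norm_le y x).trans (norm_sub_rev y x).le)
  have key : radialRetraction R x - radialRetraction R y =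
      (R / a) • (x - y) + ((R / a) * ((b - a) / b)) • y := by
    have : R / b = R / a - (R / a) * ((b - a) / b) := by field_simp; ring
    simp only [radialRetraction, ← ha, ← hb, this]
    module
  have hRa : R / a ≤ 1 := (div_le_one ha0).2 (le_max_left _ _)
  have hRa0 : 0 ≤ R / a := by positivity
  have hyb : ‖y‖ ≤ b := le_max_right _ _
  rw [key]
  refine (norm_add_le _ _).trans ?_
  rw [norm_smul, norm_smul, norm_mul, Real.norm_of_nonneg hRa0, norm_div, Real.norm_eq_abs,
    Real.norm_of_nonneg hb0.le]
  have h1 : R / a * ‖x - y‖ ≤ ‖x - y‖ := mul_le_of_le_one_left (norm_nonneg _) hRa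
  have h2 : R / a * (|b - a| / b) * ‖y‖ ≤ ‖x - y‖ := by
    calc R / a * (|b - a| / b) * ‖y‖ ≤ 1 * (|b - a| / b) * b := by gcongr
      _ = |b - a| := by field_simp
      _ ≤ _ := hab
  simp only [NNReal.coe_ofNat]
  linarith

/-- A linear bound on the derivative bounds a curve, on both sides of the initial time. -/
theorem norm_le_exp_of_norm_deriv_le {x x' : ℝ → E} {c d t₀ K : ℝ} (ht₀ : t₀ ∈ Icc c d)
    (hK : 0 ≤ K) (hx : ∀ t ∈ Icc c d, HasDerivWithinAt x (x' t) (Icc c d) t)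
    (hb : ∀ t ∈ Icc c d, ‖x' t‖ ≤ K * ‖x t‖) :
    ∀ t ∈ Icc c d, ‖x t‖ ≤ ‖x t₀‖ * Real.exp (K * (d - c)) := by
  have hc : ContinuousOn x (Icc c d) := fun t ht => (hx t ht).continuousWithinAt
  intro t ht
  rcases le_total t₀ t with h | h
  · have hs : Icc t₀ d ⊆ Icc c d := Icc_subset_Icc_left ht₀.1
    have := norm_le_gronwallBound_of_norm_deriv_right_le (δ := ‖x t₀‖) (K := K) (ε := 0)
      (hc.mono hs)
      (fun s hs' => ((hx s (hs ⟨hs'.1, hs'.2.le⟩)).mono hs).mono_of_mem_nhdsWithin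
        (Icc_mem_nhdsGE_of_mem hs')) le_rfl
      (fun s hs' => by simpa using hb s (hs ⟨hs'.1, hs'.2.le⟩)) t ⟨h, ht.2⟩
    rw [gronwallBound_ε0] at this
    refine this.trans ?_
    gcongr
    exacts [ht.2, ht₀.1]
  -- Before t₀, apply Grönwall to the time-reversed curve.
  · have hm : ∀ s ∈ Icc (-t₀) (-c), -s ∈ Icc c d := fun s hs =>
      ⟨by linarith [hs.2], by linarith [hs.1, ht₀.2]⟩
    have hd : ∀ s ∈ Icc (-t₀) (-c),
        HasDerivWithinAt (fun s => x (-s)) (-x' (-s)) (Icc (-t₀) (-c)) s := fun s hs => by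
      have := (hx (-s) (hm s hs)).scomp s (hasDerivAt_neg s).hasDerivWithinAt (s := Icc (-t₀) (-c))
        (fun r hr => hm r hr)
      simpa [Function.comp_def] using this
    have := norm_le_gronwallBound_of_norm_deriv_right_le (δ := ‖x t₀‖) (K := K) (ε := 0)
      (f := fun s => x (-s)) (f' := fun s => -x' (-s)) (a := -t₀) (b := -c)
      (fun s hs => (hd s hs).continuousWithinAt)
      (fun s hs => (hd s ⟨hs.1, hs.2.le⟩).mono_of_mem_nhdsWithin (Icc_mem_nhdsGE_of_mem hs))
      (by simp)
      (fun s hs => by simpa using hb _ (hm s ⟨hs.1, hs.2.le⟩)) (-t) ⟨by linarith, by linarith [ht.1]⟩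
    rw [gronwallBound_ε0, neg_neg] at this
    refine this.trans ?_
    have : -t - -t₀ ≤ d - c := by linarith [ht.1, ht₀.2]
    gcongr

theorem exists_nnnorm_bound {F : Type*} [NormedAddCommGroup F] {A : ℝ → F} {c d : ℝ}
    (hA : ContinuousOn A (Icc c d)) : ∃ K : ℝ≥0, ∀ t ∈ Icc c d, ‖A t‖ ≤ K := by
  obtain ⟨C, hC⟩ := isCompact_Icc.exists_bound_of_continuousOn hA
  exact ⟨C.toNNReal, fun t ht => (hC t ht).trans (Real.le_coe_toNNReal C)⟩

theorem linear_ode_unique_Ioo {A : ℝ → E →L[ℝ] E} {c d : ℝ} (hA : ContinuousOn A (Icc c d))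
    {t₀ : ℝ} (ht₀ : t₀ ∈ Ioo c d) {x y : ℝ → E}
    (hx : ∀ t ∈ Ioo c d, HasDerivAt x (A t (x t)) t)
    (hy : ∀ t ∈ Ioo c d, HasDerivAt y (A t (y t)) t) (h : x t₀ = y t₀) : EqOn x y (Ioo c d) := by
  obtain ⟨K, hK⟩ := exists_nnnorm_bound hA
  exact ODE_solution_unique_of_mem_Ioo (v := fun t => A t) (s := fun _ => univ) (K := K)
    (fun t ht => ((A t).lipschitz.weaken
      (by exact_mod_cast hK t (Ioo_subset_Icc_self ht))).lipschitzOnWith) ht₀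
    (fun t ht => ⟨hx t ht, trivial⟩) (fun t ht => ⟨hy t ht, trivial⟩) h

variable [CompleteSpace E]

/-- Existence of solutions of linear differential equations on compact intervals. -/
theorem exists_linear_ode_Icc {A : ℝ → E →L[ℝ] E} {c d : ℝ} (hA : ContinuousOn A (Icc c d))
    {t₀ : ℝ} (ht₀ : t₀ ∈ Icc c d) (x₀ : E) :
    ∃ x : ℝ → E, x t₀ = x₀ ∧ ∀ t ∈ Icc c d, HasDerivWithinAt x (A t (x t)) (Icc c d) t := by
  obtain ⟨K, hK⟩ := exists_nnnorm_bound hA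
  have hcd : 0 ≤ d - c := by linarith [ht₀.1, ht₀.2]
  -- R exceeds the a priori Grönwall bound, so truncating the field outside the ball of radius R
  -- does not affect the solution. The truncated field is bounded by K * R everywhere, which lets
  -- Picard-Lindelöf reach the whole interval at once.
  let R : ℝ≥0 := ⟨‖x₀‖ * Real.exp (K * (d - c)) + 1, by positivity⟩
  have hR : (0 : ℝ) < R := by change 0 < ‖x₀‖ * Real.exp (K * (d - c)) + 1; positivity
  let f : ℝ → E → E := fun t x => A t (radialRetraction R x)
  have hpl : IsPicardLindelof f (⟨t₀, ht₀⟩ : Icc c d) x₀ (K * R * ⟨d - c, hcd⟩) 0 (K * R)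
      (K * 2) := by
    refine ⟨fun t ht => ?_, fun x _ => ?_, fun t ht x _ => ?_, ?_⟩
    · have h1 : LipschitzWith K (A t) := (A t).lipschitz.weaken (by exact_mod_cast hK t ht)
      exact (h1.comp (lipschitzWith_radialRetraction hR)).lipschitzOnWith
    · exact hA.clm_apply continuousOn_const
    · refine ((A t).le_opNorm _).trans ?_
      rw [NNReal.coe_mul]
      gcongr
      · exact hK t ht
      · exact norm_radialRetraction_le hR x
    · rw [NNReal.coe_zero, sub_zero, NNReal.coe_mul]
      refine mul_le_mul_of_nonneg_left ?_ (K * R).coe_nonneg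
      change max (d - t₀) (t₀ - c) ≤ d - c
      exact max_le (by linarith [ht₀.1]) (by linarith [ht₀.2])
  obtain ⟨x, hx0, hx⟩ := hpl.exists_eq_forall_mem_Icc_hasDerivWithinAt₀
  have hx0 : x t₀ = x₀ := hx0
  refine ⟨x, hx0, fun t ht => ?_⟩
  -- The retraction does not increase norms, so the truncated equation satisfies the same linear
  -- bound.
  have hn := norm_le_exp_of_norm_deriv_le ht₀ K.coe_nonneg hx (fun s hs => by
    refine ((A s).le_opNorm _).trans ?_
    gcongr
    · exact hK s hs
    · exact norm_radialRetraction_le_norm hR _) t ht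
  have h2 : ‖x t‖ ≤ R := by
    rw [hx0] at hn
    refine hn.trans ?_
    change _ ≤ ‖x₀‖ * Real.exp (K * (d - c)) + 1
    linarith
  have := hx t ht
  rwa [show f t (x t) = A t (x t) by simp only [f, radialRetraction_of_norm_le hR h2]] at this

theorem exists_Icc_subset_of_mem {J : Set ℝ} (hJ : IsOpen J) (hJ' : J.OrdConnected) {s t : ℝ}
    (hs : s ∈ J) (ht : t ∈ J) : ∃ c d, s ∈ Ioo c d ∧ t ∈ Ioo c d ∧ Icc c d ⊆ J := by
  have h1 : min s t ∈ J := by rcases min_choice s t with h | h <;> rwa [h]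
  have h2 : max s t ∈ J := by rcases max_choice s t with h | h <;> rwa [h]
  obtain ⟨l, u, hlu, hl⟩ := mem_nhds_iff_exists_Ioo_subset.1 (hJ.mem_nhds h1)
  obtain ⟨l', u', hlu', hu⟩ := mem_nhds_iff_exists_Ioo_subset.1 (hJ.mem_nhds h2)
  obtain ⟨c, hc1, hc2⟩ := exists_between hlu.1
  obtain ⟨d, hd1, hd2⟩ := exists_between hlu'.2
  refine ⟨c, d, ⟨hc2.trans_le (min_le_left _ _), (le_max_left _ _).trans_lt hd1⟩,
    ⟨hc2.trans_le (min_le_right _ _), (le_max_right _ _).trans_lt hd1⟩, hJ'.out ?_ ?_⟩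
  · exact hl ⟨hc1, hc2.trans hlu.2⟩
  · exact hu ⟨hlu'.1.trans hd1, hd2⟩

/-- Existence of solutions of linear differential equations on open intervals. -/
theorem exists_linear_ode {J : Set ℝ} (hJ : IsOpen J) (hJ' : J.OrdConnected) {A : ℝ → E →L[ℝ] E}
    (hA : ContinuousOn A J) {t₀ : ℝ} (ht₀ : t₀ ∈ J) (x₀ : E) :
    ∃ x : ℝ → E, x t₀ = x₀ ∧ ∀ t ∈ J, HasDerivAt x (A t (x t)) t := by
  have H : ∀ y : J, ∃ (c d : ℝ) (x : ℝ → E), t₀ ∈ Ioo c d ∧ (y : ℝ) ∈ Ioo c d ∧ Icc c d ⊆ J ∧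
      x t₀ = x₀ ∧ ∀ t ∈ Ioo c d, HasDerivAt x (A t (x t)) t := fun y => by
    obtain ⟨c, d, h0, hy, hs⟩ := exists_Icc_subset_of_mem hJ hJ' ht₀ y.2
    obtain ⟨x, hx0, hx⟩ := exists_linear_ode_Icc (hA.mono hs) (Ioo_subset_Icc_self h0) x₀
    exact ⟨c, d, x, h0, hy, hs, hx0, fun t ht =>
      (hx t (Ioo_subset_Icc_self ht)).hasDerivAt (Icc_mem_nhds ht.1 ht.2)⟩
  choose c d x h0 hy hs hx0 hx using H
  classical
  -- Glue along the diagonal: all the local solutions start from x₀ at t₀, so uniqueness makes them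
  -- agree on overlaps.
  let X : ℝ → E := fun t => if h : t ∈ J then x ⟨t, h⟩ t else 0
  have hX : ∀ y : J, ∀ t ∈ Ioo (c y) (d y), X t = x y t := fun y t ht => by
    have htJ : t ∈ J := hs y (Ioo_subset_Icc_self ht)
    let z : J := ⟨t, htJ⟩
    have e : X t = x z t := dif_pos htJ
    rw [e]
    refine linear_ode_unique_Ioo (c := max (c y) (c z)) (d := min (d y) (d z)) (t₀ := t₀)
      (hA.mono ((Icc_subset_Icc (le_max_left _ _) (min_le_left _ _)).trans (hs y)))
      ⟨max_lt (h0 y).1 (h0 z).1, lt_min (h0 y).2 (h0 z).2⟩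
      (fun s hs' => hx z s ⟨(le_max_right _ _).trans_lt hs'.1, hs'.2.trans_le (min_le_right _ _)⟩)
      (fun s hs' => hx y s ⟨(le_max_left _ _).trans_lt hs'.1, hs'.2.trans_le (min_le_left _ _)⟩)
      ((hx0 z).trans (hx0 y).symm)
      ⟨max_lt ht.1 (hy z).1, lt_min ht.2 (hy z).2⟩
  refine ⟨X, (hX ⟨t₀, ht₀⟩ t₀ (h0 _)).trans (hx0 _), fun t ht => ?_⟩
  have hm := hy ⟨t, ht⟩
  rw [hX ⟨t, ht⟩ t hm]
  refine (hx ⟨t, ht⟩ t hm).congr_of_eventuallyEq ?_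
  filter_upwards [Ioo_mem_nhds hm.1 hm.2] with s hs' using hX ⟨t, ht⟩ s hs'

end LinearODE

/-! ### Fundamental solutions in finite-dimensional algebras. -/

section FundamentalSolution

variable {R : Type*} [NormedRing R] [NormedAlgebra ℝ R]

theorem eq_of_hasDerivAt_zero {E : Type*} [NormedAddCommGroup E] [NormedSpace ℝ E] {J : Set ℝ}
    (hJ : IsOpen J) (hJ' : J.OrdConnected) {f : ℝ → E} (hf : ∀ t ∈ J, HasDerivAt f 0 t)
    {s t : ℝ} (hs : s ∈ J) (ht : t ∈ J) : f s = f t :=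
  hJ.is_const_of_deriv_eq_zero hJ'.isPreconnected
    (fun r hr => (hf r hr).differentiableAt.differentiableWithinAt)
    (fun r hr => (hf r hr).deriv) hs ht

variable [FiniteDimensional ℝ R]

/-- The fundamental solution of the linear differential equation with coefficient `a` in a
finite-dimensional algebra, together with its inverse. -/
theorem exists_fundamental_solution {J : Set ℝ} (hJ : IsOpen J) (hJ' : J.OrdConnected) {a : ℝ → R}
    (ha : ContinuousOn a J) {t₀ : ℝ} (ht₀ : t₀ ∈ J) :
    ∃ u : ℝ → Rˣ, u t₀ = 1 ∧ (∀ t ∈ J, HasDerivAt (fun t => (u t : R)) (a t * u t) t) ∧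
      ∀ t ∈ J, HasDerivAt (fun t => ((u t)⁻¹ : Rˣ).val) (-(((u t)⁻¹ : Rˣ).val * a t)) t := by
  have : CompleteSpace R := FiniteDimensional.complete ℝ R
  -- The product y * x has derivative zero, but that of x * y is a commutator. Finiteness is what
  -- makes the left inverse y two-sided.
  have : IsArtinianRing R := IsArtinianRing.of_finite ℝ R
  obtain ⟨x, hx0, hx⟩ := exists_linear_ode hJ hJ' (A := fun t => ContinuousLinearMap.mul ℝ R (a t))
    ((ContinuousLinearMap.mul ℝ R).continuous.comp_continuousOn ha) ht₀ 1
  obtain ⟨y, hy0, hy⟩ := exists_linear_ode hJ hJ'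
    (A := fun t => -(ContinuousLinearMap.mul ℝ R).flip (a t))
    ((ContinuousLinearMap.mul ℝ R).flip.continuous.comp_continuousOn ha).neg ht₀ 1
  simp only [ContinuousLinearMap.mul_apply', neg_apply, ContinuousLinearMap.flip_apply] at hx hy
  have hyx : ∀ t ∈ J, y t * x t = 1 := fun t ht => by
    rw [eq_of_hasDerivAt_zero hJ hJ' (f := fun t => y t * x t) (fun s hs => by
      have := (hy s hs).mul (hx s hs)
      rwa [neg_mul, mul_assoc, neg_add_cancel] at this) ht ht₀, hy0, hx0, mul_one]
  classical
  let u : ℝ → Rˣ := fun t =>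
    if h : t ∈ J then ⟨x t, y t, mul_eq_one_symm (hyx t h), hyx t h⟩ else 1
  have hu : ∀ t ∈ J, (u t : R) = x t ∧ ((u t)⁻¹ : Rˣ).val = y t := fun t ht => by
    simp only [u, dif_pos ht, Units.inv_mk, and_self]
  refine ⟨u, Units.ext ((hu t₀ ht₀).1.trans hx0), fun t ht => ?_, fun t ht => ?_⟩
  · rw [(hu t ht).1]
    refine (hx t ht).congr_of_eventuallyEq ?_
    filter_upwards [hJ.mem_nhds ht] with s hs using (hu s hs).1
  · rw [(hu t ht).2]
    refine (hy t ht).congr_of_eventuallyEq ?_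
    filter_upwards [hJ.mem_nhds ht] with s hs using (hu s hs).2

/-- The fundamental solution for a coefficient in a subalgebra lies in the subalgebra. -/
theorem Subalgebra.exists_fundamental_solution (S : Subalgebra ℝ R) {J : Set ℝ} (hJ : IsOpen J)
    (hJ' : J.OrdConnected) {a : ℝ → R} (ha : ContinuousOn a J) (haS : ∀ t ∈ J, a t ∈ S) {t₀ : ℝ}
    (ht₀ : t₀ ∈ J) :
    ∃ u : ℝ → Rˣ, (∀ t, (u t : R) ∈ S ∧ ((u t)⁻¹ : Rˣ).val ∈ S) ∧ u t₀ = 1 ∧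
      (∀ t ∈ J, HasDerivAt (fun t => (u t : R)) (a t * u t) t) ∧
      ∀ t ∈ J, HasDerivAt (fun t => ((u t)⁻¹ : Rˣ).val) (-(((u t)⁻¹ : Rˣ).val * a t)) t := by
  classical
  -- Solving within S, an algebra in its own right, puts both the solution and its inverse in S by
  -- construction.
  let b : ℝ → S := fun t => if h : t ∈ J then ⟨a t, haS t h⟩ else 0
  have hb : ∀ t ∈ J, (b t : R) = a t := fun t ht => by simp only [b, dif_pos ht]
  have hbc : ContinuousOn b J := by
    rw [Topology.IsInducing.subtypeVal.continuousOn_iff]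
    exact ha.congr hb
  have : FiniteDimensional ℝ S := FiniteDimensional.finiteDimensional_subalgebra S
  obtain ⟨u, h0, hu, hu'⟩ := _root_.exists_fundamental_solution hJ hJ' hbc ht₀
  have hsub : ∀ t, HasFDerivAt (fun s : S => (s : R)) (S.toSubmodule.subtypeL) t :=
    fun t => S.toSubmodule.subtypeL.hasFDerivAt
  refine ⟨fun t => Units.map S.val.toMonoidHom (u t), fun t => ⟨(u t).val.2, ((u t)⁻¹).val.2⟩,
    by simp [h0], fun t ht => ?_, fun t ht => ?_⟩
  · have := (hsub _).comp_hasDerivAt t (hu t ht)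
    rw [← hb t ht]
    exact this
  · have := (hsub _).comp_hasDerivAt t (hu' t ht)
    rw [← hb t ht]
    exact this

end FundamentalSolution

/-! ### The Deligne bigrading. -/

namespace MixedHodge

namespace Data

variable {V : Type*} [NormedAddCommGroup V] [NormedSpace ℂ V] {D : Data V} {F : Fil V}

theorem cls_eq_zero_iff {k : ℤ} (u : D.W k) : D.cls u = 0 ↔ (u : V) ∈ D.W (k - 1) := by
  rw [Submodule.Quotient.mk_eq_zero]; rfl

theorem cls_eq_cls_iff {k : ℤ} (u v : D.W k) : D.cls u = D.cls v ↔ (u : V) - v ∈ D.W (k - 1) := by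
  rw [Submodule.Quotient.eq]; rfl

theorem mem_conjFil_iff {q : ℤ} {v : V} : v ∈ D.conjFil F q ↔ D.conj v ∈ F q := by
  constructor
  · rintro ⟨w, hw, rfl⟩
    rwa [D.conj_conj]
  · exact fun h => ⟨_, h, D.conj_conj v⟩

theorem IsMHS.antitone_conjFil (hF : D.IsMHS F) : Antitone (D.conjFil F) :=
  fun _ _ h _ hv => mem_conjFil_iff.2 (hF.antitone h (mem_conjFil_iff.1 hv))

/-- Vectors of `W m` decompose, modulo `W (m - 1)`, along `F` and the conjugate of `F`. -/
theorem IsMHS.exists_decomposition (hF : D.IsMHS F) {m p q : ℤ} (hpq : p + q = m + 1) {w : V}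
    (hw : w ∈ D.W m) :
    ∃ f ∈ F p ⊓ D.W m, ∃ g ∈ D.conjFil F q ⊓ D.W m, w - f - g ∈ D.W (m - 1) := by
  obtain rfl : q = m + 1 - p := by lia
  have h := (hF.isCompl m p).sup_eq_top.ge (Submodule.mem_top (x := D.cls ⟨w, hw⟩))
  obtain ⟨_, ⟨f, hf, rfl⟩, _, ⟨g, hg, rfl⟩, e⟩ := Submodule.mem_sup.1 h
  refine ⟨f, ⟨hf, f.2⟩, g, ⟨hg, g.2⟩, ?_⟩
  have e' : D.cls ⟨w, hw⟩ = D.cls (f + g) := e.symm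
  rw [cls_eq_cls_iff] at e'
  simpa [sub_sub] using e'

/-- This is the directness half of opposedness on Gr_m: f and g have the same class, which lies in
two subspaces that meet trivially. -/
theorem IsMHS.mem_of_sub_mem (hF : D.IsMHS F) {m p q : ℤ} (hpq : m + 1 ≤ p + q) {f g : V}
    (hf : f ∈ F p ⊓ D.W m) (hg : g ∈ D.conjFil F q ⊓ D.W m) (h : f - g ∈ D.W (m - 1)) :
    f ∈ D.W (m - 1) := by
  have hg' : g ∈ D.conjFil F (m + 1 - p) := hF.antitone_conjFil (by lia) hg.1
  have := Submodule.disjoint_def.1 (hF.isCompl m p).disjoint (D.cls ⟨f, hf.2⟩)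
    ⟨⟨f, hf.2⟩, hf.1, rfl⟩ ⟨⟨g, hg.2⟩, hg', ((cls_eq_cls_iff _ _).2 h).symm⟩
  exact (cls_eq_zero_iff _).1 this

theorem exists_W_eq_bot (D : Data V) (k : ℤ) : ∃ n : ℕ, D.W (k - n) = ⊥ := by
  obtain ⟨k₀, h⟩ := D.W_bot
  exact ⟨(k - k₀).toNat, le_bot_iff.1 ((D.W_mono (by lia)).trans h.le)⟩

/-- Apply the previous lemma with f = g = x. The weight drops by one and the inequality persists,
until W vanishes. -/
theorem IsMHS.eq_zero_of_mem (hF : D.IsMHS F) {m p q : ℤ} (hpq : m + 1 ≤ p + q) {x : V}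
    (hx : x ∈ F p) (hx' : x ∈ D.conjFil F q) (hm : x ∈ D.W m) : x = 0 := by
  have key : ∀ n : ℕ, x ∈ D.W (m - n) := by
    intro n
    induction n with
    | zero => simpa using hm
    | succ n ih =>
      have := hF.mem_of_sub_mem (m := m - n) (p := p) (q := q) (by lia) ⟨hx, ih⟩ ⟨hx', ih⟩ (by simp)
      rwa [show m - (n + 1 : ℕ) = m - n - 1 by push_cast; ring]
  obtain ⟨n, hn⟩ := D.exists_W_eq_bot m
  have := key n
  rwa [hn, Submodule.mem_bot] at this

theorem I_le_F (D : Data V) (F : Fil V) (p q : ℤ) : D.I F p q ≤ F p :=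
  inf_le_left.trans inf_le_left

theorem I_le_W (D : Data V) (F : Fil V) (p q : ℤ) : D.I F p q ≤ D.W (p + q) :=
  inf_le_left.trans inf_le_right

/-- Deligne's lifting lemma. -/
theorem IsMHS.exists_mem_I (hF : D.IsMHS F) {p q : ℤ} {x g : V} (hx : x ∈ F p)
    (hxW : x ∈ D.W (p + q)) (hg : g ∈ D.conjFil F q) (hgW : g ∈ D.W (p + q))
    (hxg : x - g ∈ D.W (p + q - 1)) : ∃ u ∈ D.I F p q, x - u ∈ D.W (p + q - 1) := by
  set S : Submodule ℂ V := D.conjFil F q ⊓ D.W (p + q) ⊔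
    ⨆ (j : ℤ) (_ : 0 < j), D.conjFil F (q - j) ⊓ D.W (p + q - 1 - j) with hS
  -- Successive correction: the error u - s in W_{p+q-1-n} is f' + g' modulo lower weight, with f'
  -- in F^p and g' in the conjugate of F^{q-n}. Subtract f' from u and add g' to s. For n = 0 the
  -- vector g' joins the leading term of S, for n > 0 the term j = n.
  have key : ∀ n : ℕ, ∃ u ∈ F p, u ∈ D.W (p + q) ∧ x - u ∈ D.W (p + q - 1) ∧
      ∃ s ∈ S, u - s ∈ D.W (p + q - 1 - n) := by
    intro n
    induction n with
    | zero => exact ⟨x, hx, hxW, by simp, g, Submodule.mem_sup_left ⟨hg, hgW⟩, by simpa using hxg⟩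
    | succ n ih =>
      obtain ⟨u, hu, huW, hxu, s, hs, hus⟩ := ih
      obtain ⟨f', hf', g', hg', e⟩ := hF.exists_decomposition (m := p + q - 1 - n) (p := p)
        (q := q - n) (by ring) hus
      have hfW : f' ∈ D.W (p + q - 1) := D.W_mono (by lia) hf'.2
      refine ⟨u - f', (F p).sub_mem hu hf'.1, (D.W _).sub_mem huW (D.W_mono (by lia) hfW), ?_,
        s + g', S.add_mem hs ?_, ?_⟩
      · convert (D.W _).add_mem hxu hfW using 1
        abel
      · rcases Nat.eq_zero_or_pos n with rfl | hn
        · exact Submodule.mem_sup_left ⟨by simpa using hg'.1, D.W_mono (by lia) hg'.2⟩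
        · exact Submodule.mem_sup_right
            ((le_iSup₂_of_le (f := fun (j : ℤ) (_ : 0 < j) =>
              D.conjFil F (q - j) ⊓ D.W (p + q - 1 - j)) (n : ℤ) (by lia) le_rfl) hg')
      · rw [show p + q - 1 - (n + 1 : ℕ) = p + q - 1 - n - 1 by push_cast; ring]
        convert e using 1
        abel
  obtain ⟨n, hn⟩ := D.exists_W_eq_bot (p + q - 1)
  obtain ⟨u, hu, huW, hxu, s, hs, hus⟩ := key n
  rw [hn, Submodule.mem_bot, sub_eq_zero] at hus
  subst hus
  exact ⟨u, ⟨⟨hu, huW⟩, hs⟩, hxu⟩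

/-- The sum of the summands `I^{a,b}` with `a ≥ p` and `a + b ≤ k`. -/
def sumI (D : Data V) (F : Fil V) (p k : ℤ) : Submodule ℂ V :=
  ⨆ (a : ℤ × ℤ) (_ : p ≤ a.1 ∧ a.1 + a.2 ≤ k), D.I F a.1 a.2

theorem I_le_sumI (D : Data V) (F : Fil V) {p k : ℤ} {a : ℤ × ℤ} (h : p ≤ a.1 ∧ a.1 + a.2 ≤ k) :
    D.I F a.1 a.2 ≤ D.sumI F p k :=
  le_iSup₂_of_le (f := fun (a : ℤ × ℤ) (_ : p ≤ a.1 ∧ a.1 + a.2 ≤ k) => D.I F a.1 a.2) a h le_rfl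

theorem sumI_mono (D : Data V) (F : Fil V) {p p' k k' : ℤ} (hp : p' ≤ p) (hk : k ≤ k') :
    D.sumI F p k ≤ D.sumI F p' k' :=
  iSup₂_le fun _ h => D.I_le_sumI F ⟨hp.trans h.1, h.2.trans hk⟩

/-- Double induction, on the weight from below and on p from above. Write x as f + u + rest, with f
in F^{p+1}, with u in I^{p,k-p} given by the lifting lemma, and with the rest in F^p ∩ W_{k-1}. -/
theorem IsMHS.inf_le_sumI (hF : D.IsMHS F) (p k : ℤ) : F p ⊓ D.W k ≤ D.sumI F p k := by
  obtain ⟨k₀, hk₀⟩ := D.W_bot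
  obtain ⟨p₁, hp₁⟩ := hF.separated
  have key : ∀ n m : ℕ, ∀ p k, k ≤ k₀ + n → p₁ - m ≤ p → F p ⊓ D.W k ≤ D.sumI F p k := by
    intro n
    induction n with
    | zero =>
      rintro m p k hk -
      have : D.W k ≤ ⊥ := (D.W_mono (by simpa using hk)).trans hk₀.le
      exact inf_le_right.trans (this.trans bot_le)
    | succ n ihn =>
      intro m
      induction m with
      | zero =>
        intro p k _ hp
        have : F p ≤ ⊥ := (hF.antitone (by simpa using hp)).trans hp₁.le
        exact inf_le_left.trans (this.trans bot_le)
      | succ m ihm =>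
        rintro p k hk hp x ⟨hx, hxW⟩
        obtain ⟨f, hf, g, hg, e⟩ := hF.exists_decomposition (p := p + 1) (q := k - p) (by ring) hxW
        have hfp : f ∈ F p := hF.antitone (by lia) hf.1
        have hpk : p + (k - p) = k := by ring
        obtain ⟨u, hu, hxu⟩ := hF.exists_mem_I (p := p) (q := k - p) (x := x - f) (g := g)
          ((F p).sub_mem hx hfp) (by rw [hpk]; exact (D.W k).sub_mem hxW hf.2) hg.1
          (by rw [hpk]; exact hg.2) (by rwa [hpk])
        rw [hpk] at hxu
        have h1 := D.sumI_mono F (show p ≤ p + 1 by lia) le_rfl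
          (ihm (p + 1) k hk (by push_cast at hp; lia) hf)
        have h2 := D.sumI_mono F le_rfl (show k - 1 ≤ k by lia) (ihn (m + 1) p (k - 1)
          (by push_cast at hk; lia) hp
          ⟨(F p).sub_mem ((F p).sub_mem hx hfp) (D.I_le_F F _ _ hu), hxu⟩)
        have h3 := D.I_le_sumI F (a := (p, k - p)) (p := p) (k := k) ⟨le_rfl, hpk.le⟩ hu
        have := Submodule.add_mem _ (Submodule.add_mem _ h1 h3) h2
        rwa [show f + u + (x - f - u) = x by abel] at this
  exact key (k - k₀).toNat (p₁ - p).toNat p k (by lia) (by lia)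

/-- `(F, W)` is a mixed Hodge structure which is split over the reals. -/
structure IsSplit (D : Data V) (F : Fil V) : Prop extends D.IsMHS F where
  map_conj_I : ∀ p q, (D.I F p q).map D.conj = D.I F q p

theorem IsSplit.conj_mem (hF : D.IsSplit F) {p q : ℤ} {v : V} (hv : v ∈ D.I F p q) :
    D.conj v ∈ D.I F q p := by
  rw [← hF.map_conj_I]
  exact ⟨v, hv, rfl⟩

theorem IsSplit.I_le_conjFil (hF : D.IsSplit F) (p q : ℤ) : D.I F p q ≤ D.conjFil F q :=
  fun _ hv => mem_conjFil_iff.2 (D.I_le_F F q p (hF.conj_mem hv))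

/-- In a relation, take the nonzero term of highest weight k = p + q and, among these, of least p.
All other terms lie in F^{p+1} ∩ W_k + W_{k-1}, whereas by splitness this one lies in the conjugate
of F^q. Opposedness pushes it into W_{k-1}, where F^p and the conjugate of F^q meet in zero. -/
theorem IsSplit.iSupIndep (hF : D.IsSplit F) : iSupIndep fun a : ℤ × ℤ => D.I F a.1 a.2 := by
  classical
  rw [iSupIndep_iff_finsetSum_eq_zero_imp_eq_zero]
  intro s v hv h0
  by_contra! hne
  obtain ⟨i, his, hi⟩ := hne
  obtain ⟨a, ha, hmax⟩ := (s.filter fun i => v i ≠ 0).exists_max_image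
    (fun i => toLex (i.1 + i.2, -i.1)) ⟨i, by simp [his, hi]⟩
  rw [Finset.mem_filter] at ha
  refine ha.2 ?_
  have hI := hv a ha.1
  set k := a.1 + a.2 with hk
  have hsum : v a = -∑ b ∈ s.erase a, v b := by
    rw [← Finset.add_sum_erase _ _ ha.1] at h0
    exact eq_neg_of_add_eq_zero_left h0
  have hrest : ∑ b ∈ s.erase a, v b ∈ F (a.1 + 1) ⊓ D.W k ⊔ D.W (k - 1) := by
    refine Submodule.sum_mem _ fun b hb => ?_
    rw [Finset.mem_erase] at hb
    by_cases hb0 : v b = 0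
    · rw [hb0]; exact Submodule.zero_mem _
    have hb' := hmax b (by simp [hb.2, hb0])
    rw [Prod.Lex.toLex_le_toLex] at hb'
    have hbI := hv b hb.2
    rcases hb' with h | ⟨h, h'⟩
    · exact Submodule.mem_sup_right (D.W_mono (by lia) (D.I_le_W F _ _ hbI))
    · refine Submodule.mem_sup_left ⟨hF.antitone ?_ (D.I_le_F F _ _ hbI),
        D.W_mono (by lia) (D.I_le_W F _ _ hbI)⟩
      have : b.1 ≠ a.1 := fun e => hb.1 (Prod.ext e (by simp only at h; lia))
      simp only at h'
      lia
  obtain ⟨f, hf, w, hw, e⟩ := Submodule.mem_sup.1 hrest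
  have hWa : v a ∈ D.W k := D.I_le_W F _ _ hI
  have h1 : f ∈ D.W (k - 1) := hF.mem_of_sub_mem (m := k) (q := a.2) (g := -v a) (by lia) hf
    ⟨Submodule.neg_mem _ (hF.I_le_conjFil _ _ hI), Submodule.neg_mem _ hWa⟩
    (by rw [hsum, ← e]; simpa using hw)
  refine hF.eq_zero_of_mem (m := k - 1) (by lia) (D.I_le_F F _ _ hI) (hF.I_le_conjFil _ _ hI) ?_
  rw [hsum, ← e]
  exact Submodule.neg_mem _ (Submodule.add_mem _ h1 hw)

theorem IsMHS.iSup_I (hF : D.IsMHS F) : ⨆ a : ℤ × ℤ, D.I F a.1 a.2 = ⊤ := by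
  obtain ⟨p, hp⟩ := hF.exhaustive
  obtain ⟨k, hk⟩ := D.W_top
  have := hF.inf_le_sumI p k
  rw [hp, hk, inf_top_eq, top_le_iff] at this
  rw [eq_top_iff, ← this]
  exact iSup₂_le fun a _ => le_iSup (fun a : ℤ × ℤ => D.I F a.1 a.2) a

/-- `P` is the family of projections of a bigrading by the summands `I^{p,q}` which is compatible
with `F`, with `W` and with the conjugation, and whose nonzero members are indexed by `s`. -/
structure IsBigrading (D : Data V) (F : Fil V) (P : ℤ × ℤ → V →L[ℂ] V) (s : Finset (ℤ × ℤ)) :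
    Prop where
  mem : ∀ a v, P a v ∈ D.I F a.1 a.2
  self : ∀ a, ∀ v ∈ D.I F a.1 a.2, P a v = v
  ne : ∀ a b, a ≠ b → ∀ v ∈ D.I F b.1 b.2, P a v = 0
  sum : ∀ v, ∑ a ∈ s, P a v = v
  zero : ∀ a, a ∉ s → P a = 0
  F_eq_zero : ∀ p, ∀ v ∈ F p, ∀ a, a.1 < p → P a v = 0
  W_eq_zero : ∀ k, ∀ v ∈ D.W k, ∀ a, k < a.1 + a.2 → P a v = 0
  conj : ∀ a v, D.conj (P a v) = P a.swap (D.conj v)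

/-- Compatibility with F and with W both come from `IsMHS.inf_le_sumI`, taking W_k = V and F^p = V
respectively. -/
theorem IsSplit.exists_isBigrading [FiniteDimensional ℂ V] (hF : D.IsSplit F) :
    ∃ P s, D.IsBigrading F P s := by
  classical
  have hind := hF.iSupIndep
  have hcompl : ∀ a : ℤ × ℤ, IsCompl (D.I F a.1 a.2)
      (⨆ (b : ℤ × ℤ) (_ : b ≠ a), D.I F b.1 b.2) := fun a =>
    ⟨hind a, by
      rw [codisjoint_iff, ← hF.iSup_I, iSup_split_single (fun b : ℤ × ℤ => D.I F b.1 b.2) a]⟩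
  have hfin : {a : ℤ × ℤ | D.I F a.1 a.2 ≠ ⊥}.Finite := WellFoundedGT.finite_ne_bot_of_iSupIndep hind
  let P : ℤ × ℤ → V →L[ℂ] V := fun a => LinearMap.toContinuousLinearMap
    (Submodule.projection _ _ (hcompl a))
  have hmem : ∀ a v, P a v ∈ D.I F a.1 a.2 := fun a v => Submodule.projection_apply_mem _ v
  have hself : ∀ a, ∀ v ∈ D.I F a.1 a.2, P a v = v := fun a v hv =>
    Submodule.projection_apply_of_mem_left _ hv
  have hne : ∀ a b, a ≠ b → ∀ v ∈ D.I F b.1 b.2, P a v = 0 := fun a b hab v hv =>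
    Submodule.projection_apply_of_mem_right _
      ((le_iSup₂_of_le (f := fun (b : ℤ × ℤ) (_ : b ≠ a) => D.I F b.1 b.2) b hab.symm le_rfl) hv)
  have hzero : ∀ a, a ∉ hfin.toFinset → P a = 0 := fun a ha => by
    ext v
    have : D.I F a.1 a.2 = ⊥ := by simpa using ha
    have h := hmem a v
    rwa [this, Submodule.mem_bot] at h
  have hsumI : ∀ p k, ∀ v ∈ D.sumI F p k, ∀ a : ℤ × ℤ, ¬(p ≤ a.1 ∧ a.1 + a.2 ≤ k) → P a v = 0 := by
    intro p k v hv a ha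
    have : D.sumI F p k ≤ LinearMap.ker (P a : V →ₗ[ℂ] V) :=
      iSup₂_le fun b hb w hw => hne a b (by rintro rfl; exact ha hb) w hw
    exact this hv
  refine ⟨P, hfin.toFinset, hmem, hself, hne, fun v => ?_, hzero, fun p v hv a ha => ?_,
    fun k v hv a ha => ?_, fun a v => ?_⟩
  · have hv : v ∈ ⨆ a : ℤ × ℤ, D.I F a.1 a.2 := by rw [hF.iSup_I]; trivial
    induction hv using Submodule.iSup_induction' with
    | mem b w hw =>
      rw [Finset.sum_eq_single b (fun a _ hab => hne a b hab w hw), hself b w hw]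
      intro hb
      rw [hzero b hb]; rfl
    | zero => simp
    | add x y _ _ hx hy => simp only [map_add, Finset.sum_add_distrib, hx, hy]
  · obtain ⟨k, hk⟩ := D.W_top
    exact hsumI p k v (hF.inf_le_sumI p k ⟨hv, by rw [hk]; trivial⟩) a (by lia)
  · obtain ⟨p, hp⟩ := hF.exhaustive
    exact hsumI p k v (hF.inf_le_sumI p k ⟨by rw [hp]; trivial, hv⟩) a (by lia)
  · have hv : v ∈ ⨆ a : ℤ × ℤ, D.I F a.1 a.2 := by rw [hF.iSup_I]; trivial
    induction hv using Submodule.iSup_induction' with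
    | mem b w hw =>
      have hw' : D.conj w ∈ D.I F b.swap.1 b.swap.2 := hF.conj_mem hw
      by_cases h : a = b
      · subst h
        rw [hself a w hw, hself _ _ hw']
      · rw [hne a b h w hw, map_zero, hne _ b.swap (by simpa [Prod.swap_inj] using h) _ hw']
    | zero => simp
    | add x y _ _ hx hy => simp only [map_add, hx, hy]

/-- Summands of the bigrading of weight `k` are orthogonal unless they are conjugate. -/
theorem IsSplit.Q_eq_zero (hF : D.IsSplit F) (hQ : D.IsPolarized F) {k : ℤ} {a b : ℤ × ℤ}
    (ha : a.1 + a.2 = k) (hb : b.1 + b.2 = k) (hab : a ≠ b.swap) (u v : D.W k)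
    (hu : (u : V) ∈ D.I F a.1 a.2) (hv : (v : V) ∈ D.I F b.1 b.2) :
    D.Q k (D.cls u) (D.cls v) = 0 := by
  have key : ∀ (p q : ℤ), k + 1 ≤ p + q → ∀ u v : D.W k, (u : V) ∈ F p → (v : V) ∈ F q →
      D.Q k (D.cls u) (D.cls v) = 0 := fun p q h u v hu hv =>
    hQ.orthogonal k p _ ⟨u, hu, rfl⟩ _ ⟨v, hF.antitone (by lia) hv, rfl⟩
  -- The first bilinear relation applies to the first indices if their sum exceeds k. If the sum is
  -- below k, it applies after conjugation to the second indices; equality would make a and b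
  -- conjugate.
  rcases lt_trichotomy (k : ℤ) (a.1 + b.1) with h | h | h
  · exact key a.1 b.1 (by lia) u v (D.I_le_F F _ _ hu) (D.I_le_F F _ _ hv)
  · exact absurd (Prod.ext (by simp; lia) (by simp; lia)) hab
  · have h1 := key a.2 b.2 (by lia) ⟨_, D.W_real k u u.2⟩ ⟨_, D.W_real k v v.2⟩
      (D.I_le_F F _ _ (hF.conj_mem hu)) (D.I_le_F F _ _ (hF.conj_mem hv))
    rw [D.Q_real k u v ⟨_, D.W_real k u u.2⟩ ⟨_, D.W_real k v v.2⟩ rfl rfl] at h1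
    simpa using h1

end Data

end MixedHodge

/-! ### Multipliers by type, and the operator L. -/

namespace MixedHodge

namespace Data

section Multiplier

variable {V : Type*} [NormedAddCommGroup V] [NormedSpace ℂ V]

/-- The operator which multiplies the component of type `r` of an endomorphism, with respect to
the bigrading with projections `P`, by `ε r`. -/
noncomputable def multiplier (P : ℤ × ℤ → V →L[ℂ] V) (s : Finset (ℤ × ℤ)) (ε : ℤ × ℤ → ℂ) :
    (V →L[ℂ] V) →ₗ[ℂ] (V →L[ℂ] V) :=
  ∑ a ∈ s, ∑ b ∈ s, ε (b - a) • (LinearMap.mulLeft ℂ (P b) ∘ₗ LinearMap.mulRight ℂ (P a))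

theorem multiplier_apply_apply (P : ℤ × ℤ → V →L[ℂ] V) (s : Finset (ℤ × ℤ)) (ε : ℤ × ℤ → ℂ)
    (α : V →L[ℂ] V) (v : V) :
    multiplier P s ε α v = ∑ a ∈ s, ∑ b ∈ s, ε (b - a) • P b (α (P a v)) := by
  simp [multiplier, LinearMap.sum_apply]

theorem multiplier_add (P : ℤ × ℤ → V →L[ℂ] V) (s : Finset (ℤ × ℤ)) (ε ε' : ℤ × ℤ → ℂ) :
    multiplier P s (ε + ε') = multiplier P s ε + multiplier P s ε' := by
  simp [multiplier, add_smul, Finset.sum_add_distrib]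

theorem multiplier_sub (P : ℤ × ℤ → V →L[ℂ] V) (s : Finset (ℤ × ℤ)) (ε ε' : ℤ × ℤ → ℂ) :
    multiplier P s (ε - ε') = multiplier P s ε - multiplier P s ε' := by
  rw [eq_sub_iff_add_eq, ← multiplier_add, sub_add_cancel]

theorem multiplier_smul (P : ℤ × ℤ → V →L[ℂ] V) (s : Finset (ℤ × ℤ)) (c : ℂ) (ε : ℤ × ℤ → ℂ) :
    multiplier P s (c • ε) = c • multiplier P s ε := by
  simp [multiplier, mul_smul, Finset.smul_sum]

theorem multiplier_eq_sum (P : ℤ × ℤ → V →L[ℂ] V) (s : Finset (ℤ × ℤ)) (ε : ℤ × ℤ → ℂ) :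
    multiplier P s ε = ∑ r ∈ (s ×ˢ s).image (fun x => x.2 - x.1),
      ε r • multiplier P s (Pi.single r 1) := by
  simp only [multiplier, Finset.smul_sum]
  conv_rhs => rw [Finset.sum_comm]
  refine Finset.sum_congr rfl fun a ha => ?_
  conv_rhs => rw [Finset.sum_comm]
  refine Finset.sum_congr rfl fun b hb => ?_
  rw [Finset.sum_eq_single (b - a)]
  · simp
  · intro r _ hr
    simp [hr.symm]
  · intro h
    exact absurd (Finset.mem_image.2 ⟨(a, b), Finset.mk_mem_product ha hb, rfl⟩) h

end Multiplier

variable {V : Type*} [NormedAddCommGroup V] [NormedSpace ℂ V] {D : Data V} {F : Fil V}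
  {P : ℤ × ℤ → V →L[ℂ] V} {s : Finset (ℤ × ℤ)}

theorem eq_zero_of_forall_mem_W (D : Data V) {v : V} (h : ∀ k, v ∈ D.W k) : v = 0 := by
  obtain ⟨k, hk⟩ := D.W_bot
  have := h k
  rwa [hk, Submodule.mem_bot] at this

namespace IsBigrading

theorem ext (hB : D.IsBigrading F P s) {A B : V →L[ℂ] V}
    (h : ∀ a : ℤ × ℤ, ∀ v ∈ D.I F a.1 a.2, A v = B v) : A = B := by
  ext v
  rw [← hB.sum v, map_sum, map_sum]
  exact Finset.sum_congr rfl fun a _ => h a _ (hB.mem a v)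

theorem mem_W (hB : D.IsBigrading F P s) (a : ℤ × ℤ) (v : V) : P a v ∈ D.W (a.1 + a.2) :=
  D.I_le_W F _ _ (hB.mem a v)

theorem apply_mem_W (hB : D.IsBigrading F P s) {k : ℤ} {v : V} (hv : v ∈ D.W k) (a : ℤ × ℤ) :
    P a v ∈ D.W k := by
  rcases le_or_gt (a.1 + a.2) k with h | h
  · exact D.W_mono h (hB.mem_W a v)
  · rw [hB.W_eq_zero k v hv a h]; exact Submodule.zero_mem _

theorem multiplier_apply_of_mem (hB : D.IsBigrading F P s) (ε : ℤ × ℤ → ℂ) (α : V →L[ℂ] V)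
    {a : ℤ × ℤ} {v : V} (hv : v ∈ D.I F a.1 a.2) :
    multiplier P s ε α v = ∑ b ∈ s, ε (b - a) • P b (α v) := by
  rw [multiplier_apply_apply, Finset.sum_eq_single a]
  · rw [hB.self a v hv]
  · intro b _ hb
    simp [hB.ne b a hb v hv]
  · intro ha
    simp [hB.zero a ha]

theorem multiplier_one (hB : D.IsBigrading F P s) (α : V →L[ℂ] V) :
    multiplier P s 1 α = α :=
  hB.ext fun a v hv => by
    rw [hB.multiplier_apply_of_mem _ _ hv]
    simpa using hB.sum (α v)

theorem multiplier_single_apply_of_mem (hB : D.IsBigrading F P s) (r : ℤ × ℤ) (α : V →L[ℂ] V)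
    {a : ℤ × ℤ} {v : V} (hv : v ∈ D.I F a.1 a.2) :
    multiplier P s (Pi.single r 1) α v = P (a + r) (α v) := by
  rw [hB.multiplier_apply_of_mem _ _ hv, Finset.sum_eq_single (a + r)]
  · simp
  · intro b _ hb
    rw [Pi.single_eq_of_ne (by rintro rfl; simp at hb), zero_smul]
  · intro h
    simp [hB.zero _ h]

theorem multiplier_of_mem_g (hB : D.IsBigrading F P s) (ε : ℤ × ℤ → ℂ) {r : ℤ × ℤ}
    {α : V →L[ℂ] V} (hα : α ∈ D.g F r.1 r.2) : multiplier P s ε α = ε r • α :=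
  hB.ext fun a v hv => by
    have h : α v ∈ D.I F (a + r).1 (a + r).2 := hα.2 _ _ v hv
    rw [hB.multiplier_apply_of_mem _ _ hv, Finset.sum_eq_single (a + r)]
    · rw [hB.self _ _ h]; simp
    · intro b _ hb
      rw [hB.ne b _ hb _ h, smul_zero]
    · intro hs
      simp [hB.zero _ hs]

/-- An operator which shifts weights by at most l has no component of weight above l, so the values
of the symbol there are irrelevant. -/
theorem multiplier_mem_W (hB : D.IsBigrading F P s) {ε : ℤ × ℤ → ℂ} {l m : ℤ} {α : V →L[ℂ] V}
    (hα : ∀ k, ∀ v ∈ D.W k, α v ∈ D.W (k + l))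
    (hε : ∀ r : ℤ × ℤ, m < r.1 + r.2 → r.1 + r.2 ≤ l → ε r = 0) {k : ℤ} {v : V}
    (hv : v ∈ D.W k) : multiplier P s ε α v ∈ D.W (k + m) := by
  rw [multiplier_apply_apply]
  refine Submodule.sum_mem _ fun a _ => Submodule.sum_mem _ fun b _ => ?_
  rcases lt_or_ge k (a.1 + a.2) with h | h
  · rw [hB.W_eq_zero k v hv a h]
    simp
  have h1 := hα _ _ (hB.mem_W a v)
  rcases lt_or_ge (a.1 + a.2 + l) (b.1 + b.2) with h' | h'
  · rw [hB.W_eq_zero _ _ h1 b h']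
    simp
  rcases lt_or_ge m (b.1 + b.2 - (a.1 + a.2)) with h2 | h2
  · rw [hε (b - a) (by simp; lia) (by simp; lia), zero_smul]
    exact Submodule.zero_mem _
  · exact Submodule.smul_mem _ _ (D.W_mono (by lia) (hB.mem_W b _))

theorem multiplier_eq_zero (hB : D.IsBigrading F P s) {ε : ℤ × ℤ → ℂ} {l : ℤ} {α : V →L[ℂ] V}
    (hα : ∀ k, ∀ v ∈ D.W k, α v ∈ D.W (k + l)) (hε : ∀ r : ℤ × ℤ, r.1 + r.2 ≤ l → ε r = 0) :
    multiplier P s ε α = 0 := by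
  ext v
  obtain ⟨k, hk⟩ := D.W_top
  refine D.eq_zero_of_forall_mem_W fun j => ?_
  have := hB.multiplier_mem_W (m := j - k) hα (fun r _ h => hε r h) (k := k) (v := v)
    (by rw [hk]; trivial)
  rwa [add_sub_cancel] at this

/-- A multiplier which kills the components of types `(r, s)` with `r < 0` gives operators which
preserve the filtration `F`. -/
theorem multiplier_mem_F (hB : D.IsBigrading F P s) (hF : Antitone F) {ε : ℤ × ℤ → ℂ}
    (hε : ∀ r : ℤ × ℤ, r.1 < 0 → ε r = 0) (α : V →L[ℂ] V) {p : ℤ} {v : V} (hv : v ∈ F p) :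
    multiplier P s ε α v ∈ F p := by
  rw [multiplier_apply_apply]
  refine Submodule.sum_mem _ fun a _ => Submodule.sum_mem _ fun b _ => ?_
  rcases lt_or_ge a.1 p with h | h
  · rw [hB.F_eq_zero p v hv a h]
    simp
  rcases lt_or_ge b.1 a.1 with h' | h'
  · rw [hε (b - a) (by simpa using h'), zero_smul]
    exact Submodule.zero_mem _
  · exact Submodule.smul_mem _ _ (hF (h.trans h') (D.I_le_F F _ _ (hB.mem b _)))

/-- A bilinear form which vanishes on the summands of weight at most `k` vanishes on `W k`. -/
theorem bilin_eq_zero (hB : D.IsBigrading F P s) {k : ℤ} (C : V →ₗ[ℂ] V →ₗ[ℂ] ℂ)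
    (hC : ∀ a b : ℤ × ℤ, a.1 + a.2 ≤ k → b.1 + b.2 ≤ k → ∀ u ∈ D.I F a.1 a.2,
      ∀ v ∈ D.I F b.1 b.2, C u v = 0) {u v : V} (hu : u ∈ D.W k) (hv : v ∈ D.W k) :
    C u v = 0 := by
  rw [← hB.sum u, ← hB.sum v, map_sum C, LinearMap.sum_apply]
  refine Finset.sum_eq_zero fun a _ => ?_
  rw [map_sum]
  refine Finset.sum_eq_zero fun b _ => ?_
  rcases lt_or_ge k (a.1 + a.2) with h | h
  · rw [hB.W_eq_zero k u hu a h]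
    simp
  rcases lt_or_ge k (b.1 + b.2) with h' | h'
  · rw [hB.W_eq_zero k v hv b h']
    simp
  exact hC a b h h' _ (hB.mem a u) _ (hB.mem b v)

variable [FiniteDimensional ℂ V]

/-- For u in I^a and v in I^b of weight k, the form sees only conjugate types. Hence replacing α by
its component of type r keeps Q(αu, v) if a + r is conjugate to b and kills it otherwise; the same
holds for Q(u, αv) and b + r. As a and b have equal weight, the two conditions coincide, so both
terms survive or both vanish. -/
theorem multiplier_single_mem_lieGC (hB : D.IsBigrading F P s) (hF : D.IsSplit F)
    (hQ : D.IsPolarized F) {α : V →L[ℂ] V} (hα : α ∈ D.lieGC) (r : ℤ × ℤ) :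
    multiplier P s (Pi.single r 1) α ∈ D.lieGC := by
  have hαW : ∀ k, ∀ v ∈ D.W k, α v ∈ D.W (k + 0) := by simpa using hα.1
  set T := multiplier P s (Pi.single r 1) α with hT
  have hTW : ∀ k, ∀ v ∈ D.W k, T v ∈ D.W k := fun k v hv => by
    have := hB.multiplier_mem_W (ε := Pi.single r 1) (m := 0) hαW (fun r h h' => by lia) hv
    rwa [add_zero] at this
  refine ⟨hTW, fun k u v u' v' hu hv => ?_⟩
  obtain ⟨B, hBQ⟩ := D.exists_form k
  have hBQ' : ∀ u v (hu : u ∈ D.W k) (hv : v ∈ D.W k),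
      B u v = D.Q k (D.cls ⟨u, hu⟩) (D.cls ⟨v, hv⟩) := fun u v hu hv => hBQ ⟨u, hu⟩ ⟨v, hv⟩
  have hk1 : D.W (k - 1) ≤ D.W k := D.W_mono (by lia)
  have hsymm : ∀ u ∈ D.W k, ∀ v ∈ D.W k, B u v = (-1) ^ k * B v u := fun u hu v hv => by
    rw [hBQ' u v hu hv, hBQ' v u hv hu, D.Q_parity]
  have hl : ∀ u ∈ D.W (k - 1), ∀ v ∈ D.W k, B u v = 0 := fun u hu v hv => by
    rw [hBQ' u v (hk1 hu) hv, (cls_eq_zero_iff ⟨u, hk1 hu⟩).2 hu, map_zero, LinearMap.zero_apply]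
  have hr : ∀ u ∈ D.W k, ∀ v ∈ D.W (k - 1), B u v = 0 := fun u hu v hv => by
    rw [hsymm u hu v (hk1 hv), hl v hv u hu, mul_zero]
  have horth : ∀ a b : ℤ × ℤ, a.1 + a.2 = k → b ≠ a.swap → ∀ w ∈ D.W k, ∀ v ∈ D.I F a.1 a.2,
      B (P b w) v = 0 := by
    intro a b ha hab w hw v hv
    have hvW : v ∈ D.W k := by simpa [ha] using D.I_le_W F _ _ hv
    rcases lt_trichotomy (b.1 + b.2) k with h | h | h
    · exact hl _ (D.W_mono (by lia) (hB.mem_W b w)) v hvW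
    · rw [hBQ' _ _ (hB.apply_mem_W hw b) hvW]
      exact hF.Q_eq_zero hQ h ha hab _ _ (hB.mem b w) hv
    · rw [hB.W_eq_zero k w hw b h]
      simp
  have hleft : ∀ a b : ℤ × ℤ, a.1 + a.2 = k → ∀ w ∈ D.W k, ∀ v ∈ D.I F a.1 a.2,
      B (P b w) v = if b = a.swap then B w v else 0 := by
    intro a b ha w hw v hv
    split_ifs with hab
    · subst hab
      have : B w v = ∑ c ∈ s, B (P c w) v := by
        conv_lhs => rw [← hB.sum w]
        rw [map_sum, sum_apply]
      rw [this, Finset.sum_eq_single a.swap]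
      · exact fun c _ hc => horth a c ha hc w hw v hv
      · intro h
        simp [hB.zero _ h]
    · exact horth a b ha hab w hw v hv
  have hright : ∀ a b : ℤ × ℤ, a.1 + a.2 = k → ∀ w ∈ D.W k, ∀ u ∈ D.I F a.1 a.2,
      B u (P b w) = if b = a.swap then B u w else 0 := by
    intro a b ha w hw u hu
    have huW : u ∈ D.W k := by simpa [ha] using D.I_le_W F _ _ hu
    rw [hsymm u huW _ (hB.apply_mem_W hw b), hleft a b ha w hw u hu, hsymm u huW w hw, mul_ite,
      mul_zero]
  let C : V →ₗ[ℂ] V →ₗ[ℂ] ℂ := LinearMap.mk₂ ℂ (fun u v => B (T u) v + B u (T v))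
    (by intros; simp; ring) (by intros; simp; ring) (by intros; simp; ring)
    (by intros; simp; ring)
  have key : C u v = 0 := by
    refine hB.bilin_eq_zero C ?_ u.2 v.2
    intro a b ha hb u hu v hv
    change B (T u) v + B u (T v) = 0
    have huW := D.I_le_W F _ _ hu
    have hvW := D.I_le_W F _ _ hv
    have huk := D.W_mono ha huW
    have hvk := D.W_mono hb hvW
    rcases ha.lt_or_eq with ha' | ha'
    · have h1 := D.W_mono (show a.1 + a.2 ≤ k - 1 by lia) huW
      rw [hl _ (hTW _ _ h1) v hvk, hl u h1 _ (hTW _ _ hvk), add_zero]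
    rcases hb.lt_or_eq with hb' | hb'
    · have h1 := D.W_mono (show b.1 + b.2 ≤ k - 1 by lia) hvW
      rw [hr _ (hTW _ _ huk) v h1, hr u huk _ (hTW _ _ h1), add_zero]
    rw [hT, hB.multiplier_single_apply_of_mem r α hu, hB.multiplier_single_apply_of_mem r α hv,
      hleft b _ hb' _ (hα.1 k u huk) v hv, hright a _ ha' _ (hα.1 k v hvk) u hu]
    have hiff : a + r = b.swap ↔ b + r = a.swap := by
      simp only [Prod.ext_iff, Prod.fst_add, Prod.snd_add, Prod.fst_swap, Prod.snd_swap]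
      constructor <;> rintro ⟨h, h'⟩ <;> constructor <;> lia
    simp only [hiff]
    split_ifs
    · rw [hBQ' _ _ (hα.1 k u huk) hvk, hBQ' _ _ huk (hα.1 k v hvk)]
      exact hα.2 k ⟨u, huk⟩ ⟨v, hvk⟩ _ _ rfl rfl
    · exact add_zero 0
  rw [← hBQ, ← hBQ, hu, hv]
  exact key

theorem multiplier_mem_lieGC (hB : D.IsBigrading F P s) (hF : D.IsSplit F)
    (hQ : D.IsPolarized F) {α : V →L[ℂ] V} (hα : α ∈ D.lieGC) (ε : ℤ × ℤ → ℂ) :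
    multiplier P s ε α ∈ D.lieGC := by
  rw [multiplier_eq_sum, LinearMap.sum_apply]
  exact Submodule.sum_mem _ fun r _ =>
    Submodule.smul_mem _ _ (hB.multiplier_single_mem_lieGC hF hQ hα r)

theorem multiplier_single_mem_g (hB : D.IsBigrading F P s) (hF : D.IsSplit F)
    (hQ : D.IsPolarized F) {α : V →L[ℂ] V} (hα : α ∈ D.lieGC) (r : ℤ × ℤ) :
    multiplier P s (Pi.single r 1) α ∈ D.g F r.1 r.2 := by
  refine ⟨hB.multiplier_single_mem_lieGC hF hQ hα r, fun p q v hv => ?_⟩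
  rw [hB.multiplier_single_apply_of_mem (a := (p, q)) r α hv]
  exact hB.mem ((p, q) + r) _

theorem multiplier_mem_of_g_le (hB : D.IsBigrading F P s) (hF : D.IsSplit F)
    (hQ : D.IsPolarized F) {α : V →L[ℂ] V} (hα : α ∈ D.lieGC) {ε : ℤ × ℤ → ℂ}
    {S : Submodule ℂ (V →L[ℂ] V)} (h : ∀ r : ℤ × ℤ, ε r ≠ 0 → D.g F r.1 r.2 ≤ S) :
    multiplier P s ε α ∈ S := by
  rw [multiplier_eq_sum, LinearMap.sum_apply]
  refine Submodule.sum_mem _ fun r _ => ?_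
  by_cases hr : ε r = 0
  · simp [hr]
  · exact Submodule.smul_mem _ _ (h r hr (hB.multiplier_single_mem_g hF hQ hα r))

end IsBigrading

theorem g_le_etaPlus (D : Data V) (F : Fil V) {r : ℤ × ℤ} (h : 0 ≤ r.1 ∧ r.2 < 0) :
    D.g F r.1 r.2 ≤ D.etaPlus F := by
  unfold etaPlus
  exact le_iSup_of_le r.1 (le_iSup_of_le r.2 (le_iSup_of_le h le_rfl))

theorem g_le_etaMinus_sup_Lam (D : Data V) (F : Fil V) {r : ℤ × ℤ} (h : r.1 < 0) :
    D.g F r.1 r.2 ≤ D.etaMinus F ⊔ D.Lam F := by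
  unfold etaMinus Lam
  rcases le_or_gt 0 r.2 with h' | h'
  · exact le_sup_of_le_left (le_iSup_of_le r.1 (le_iSup_of_le r.2 (le_iSup_of_le ⟨h, h'⟩ le_rfl)))
  · exact le_sup_of_le_right (le_iSup_of_le r.1 (le_iSup_of_le r.2 (le_iSup_of_le ⟨h, h'⟩ le_rfl)))

/-- The multiplier which gives the operator `L`. -/
noncomputable def signL (r : ℤ × ℤ) : ℂ :=
  if r.1 < 0 then -Complex.I else if r.2 < 0 then Complex.I else 0

namespace IsBigrading

variable [FiniteDimensional ℂ V]

/-- Since α preserves W, its components have weight at most 0, and (0,0) is the only such type with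
both indices nonnegative. The three indicator symbols therefore sum to 1 on all relevant types. -/
theorem exists_isComponents (hB : D.IsBigrading F P s) (hF : D.IsSplit F)
    (hQ : D.IsPolarized F) {α : V →L[ℂ] V} (hα : α ∈ D.lieGC) : ∃ t, D.IsComponents F α t := by
  classical
  let e₁ : ℤ × ℤ → ℂ := fun r => if 0 ≤ r.1 ∧ r.2 < 0 then 1 else 0
  let e₂ : ℤ × ℤ → ℂ := fun r => if r = 0 then 1 else 0
  let e₃ : ℤ × ℤ → ℂ := fun r => if r.1 < 0 then 1 else 0
  refine ⟨(multiplier P s e₁ α, multiplier P s e₂ α, multiplier P s e₃ α),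
    hB.multiplier_mem_of_g_le hF hQ hα fun r hr => D.g_le_etaPlus F (by simpa [e₁] using hr),
    hB.multiplier_mem_of_g_le hF hQ hα fun r hr => ?_,
    hB.multiplier_mem_of_g_le hF hQ hα fun r hr => D.g_le_etaMinus_sup_Lam F
      (by simpa [e₃] using hr), ?_⟩
  · obtain rfl : r = 0 := by simpa [e₂] using hr
    exact le_rfl
  · have h0 := hB.multiplier_eq_zero (α := α) (ε := 1 - (e₁ + e₂ + e₃)) (l := 0)
      (by simpa using hα.1) (fun r hr => by
        by_cases h1 : r.1 < 0
        · have : r ≠ 0 := by rintro rfl; simp at h1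
          simp [e₁, e₂, e₃, h1, this]
        · by_cases h2 : r.2 < 0
          · have : r ≠ 0 := by rintro rfl; simp at h2
            simp [e₁, e₂, e₃, h1, h2, this, not_lt.1 h1]
          · obtain rfl : r = 0 := Prod.ext (by simp; lia) (by simp; lia)
            simp [e₁, e₂, e₃])
    rw [multiplier_sub, multiplier_add, multiplier_add, LinearMap.sub_apply, hB.multiplier_one,
      sub_eq_zero] at h0
    exact h0

/-- The multiplier is scalar on each of the three summands, so every triple of components, including
the chosen one, yields the same value. -/
theorem L_eq_multiplier (hB : D.IsBigrading F P s) (hF : D.IsSplit F)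
    (hQ : D.IsPolarized F) {α : V →L[ℂ] V} (hα : α ∈ D.lieGC) :
    D.L F α = multiplier P s signL α := by
  have h := hB.exists_isComponents hF hQ hα
  have key : ∀ (c : ℂ) (r : ℤ × ℤ), signL r = c →
      D.g F r.1 r.2 ≤ LinearMap.ker (multiplier P s signL - c • LinearMap.id) := by
    rintro _ r rfl x hx
    simp [hB.multiplier_of_mem_g signL hx]
  have h₁ : D.etaPlus F ≤ LinearMap.ker (multiplier P s signL - Complex.I • LinearMap.id) :=
    iSup_le fun r => iSup₂_le fun q hr => key _ (r, q) (by simp [signL, hr.1.not_gt, hr.2])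
  have h₂ : D.etaZero F ≤ LinearMap.ker (multiplier P s signL - (0 : ℂ) • LinearMap.id) :=
    key 0 0 (by simp [signL])
  have h₃ : D.etaMinus F ⊔ D.Lam F ≤
      LinearMap.ker (multiplier P s signL - (-Complex.I) • LinearMap.id) :=
    sup_le (iSup_le fun r => iSup₂_le fun q hr => key _ (r, q) (by simp [signL, hr.1]))
      (iSup_le fun r => iSup₂_le fun q hr => key _ (r, q) (by simp [signL, hr.1]))
  rw [L, dif_pos h]
  obtain ⟨c₁, c₂, c₃, e⟩ := h.choose_spec
  have d₁ := h₁ c₁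
  have d₂ := h₂ c₂
  have d₃ := h₃ c₃
  simp only [LinearMap.mem_ker, LinearMap.sub_apply, LinearMap.smul_apply, LinearMap.id_apply,
    sub_eq_zero] at d₁ d₂ d₃
  conv_rhs => rw [e, map_add, map_add, d₁, d₂, d₃]
  simp [sub_eq_add_neg]

end IsBigrading

/-- The conjugate of an endomorphism. -/
noncomputable def conjOp [FiniteDimensional ℂ V] (D : Data V) (α : V →L[ℂ] V) : V →L[ℂ] V :=
  LinearMap.toContinuousLinearMap (D.conj.comp ((α : V →ₗ[ℂ] V).comp D.conj))

theorem conjOp_apply [FiniteDimensional ℂ V] (D : Data V) (α : V →L[ℂ] V) (v : V) :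
    D.conjOp α v = D.conj (α (D.conj v)) := rfl

namespace IsBigrading

variable [FiniteDimensional ℂ V]

/-- Conjugation exchanges I^{p,q} and I^{q,p}, hence types (r,s) and (s,r), and is conjugate-linear
on the symbol. -/
theorem conj_multiplier (hB : D.IsBigrading F P s) (ε : ℤ × ℤ → ℂ) (α : V →L[ℂ] V) (v : V) :
    D.conj (multiplier P s ε α v) =
      multiplier P s (fun r => starRingEnd ℂ (ε r.swap)) (D.conjOp α) (D.conj v) := by
  have hconj : ∀ x, D.conj v = x → D.conj x = v := fun x hx => by rw [← hx, D.conj_conj]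
  have hv := hB.sum v
  rw [← hv]
  simp only [map_sum]
  refine Finset.sum_congr rfl fun a _ => ?_
  have ha := hB.mem a v
  have ha' : D.conj (P a v) ∈ D.I F a.swap.1 a.swap.2 := by
    rw [hB.conj]; exact hB.mem _ _
  rw [hB.multiplier_apply_of_mem _ _ ha, hB.multiplier_apply_of_mem _ _ ha', conjOp_apply,
    D.conj_conj, map_sum]
  have hz : ∀ b, b.swap ∉ s → P b = 0 := fun b hb => by
    ext w
    have : D.conj (P b w) = 0 := by rw [hB.conj, hB.zero _ hb]; rfl
    rw [← D.conj_conj (P b w), this, map_zero]; rfl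
  -- The index set s is not assumed stable under the swap, so only nonzero terms are matched.
  refine Finset.sum_bij_ne_zero (fun b _ _ => b.swap) ?_ ?_ ?_ ?_
  · intro b _ hb
    by_contra h
    refine hb ?_
    simp [hz b h]
  · intro b _ _ c _ _ h
    exact Prod.swap_injective h
  · intro b hb hb0
    refine ⟨b.swap, ?_, ?_, b.swap_swap⟩
    · by_contra h
      refine hb0 ?_
      simp [hz b h]
    · intro h
      refine hb0 ?_
      rw [LinearMap.map_smulₛₗ, hB.conj, Prod.swap_swap] at h
      exact h
  · intro b _ _
    rw [LinearMap.map_smulₛₗ, hB.conj]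
    rfl

/-- The defect of reality has two sources. One is that of α itself, which lowers weights by 2, as
multipliers preserve. The other is the difference between the symbol and its conjugate-swap, which
vanishes in weights 0 and -1: there either exactly one index is negative or the type is (0,0). -/
theorem multiplier_signL_mem_lieH (hB : D.IsBigrading F P s) (hF : D.IsSplit F)
    (hQ : D.IsPolarized F) {α : V →L[ℂ] V} (hα : α ∈ D.lieH) :
    multiplier P s signL α ∈ D.lieH := by
  refine ⟨hB.multiplier_mem_lieGC hF hQ hα.1 _, fun k v hv => ?_⟩
  set ε' : ℤ × ℤ → ℂ := fun r => starRingEnd ℂ (signL r.swap) with hε'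
  have e : D.conj (multiplier P s signL α v) - multiplier P s signL α (D.conj v) =
      multiplier P s ε' (D.conjOp α - α) (D.conj v) +
        multiplier P s (ε' - signL) α (D.conj v) := by
    rw [hB.conj_multiplier, map_sub, multiplier_sub]
    simp [hε']
  have hv' := D.W_real k v hv
  rw [e]
  refine Submodule.add_mem _ ?_ ?_
  · refine hB.multiplier_mem_W (l := -2) (m := -2) (fun j w hw => ?_) (fun r h h' => by lia) hv'
    have := hα.2 j _ (D.W_real j w hw)
    rwa [D.conj_conj] at this
  · refine hB.multiplier_mem_W (l := 0) (m := -2) (by simpa using hα.1.1) (fun r h h' => ?_) hv'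
    simp only [hε', signL, Pi.sub_apply, Prod.fst_swap, Prod.snd_swap]
    by_cases h1 : r.1 < 0
    · simp [h1, show ¬ r.2 < 0 by lia]
    · by_cases h2 : r.2 < 0
      · simp [h1, h2]
      · simp [h1, h2]

end IsBigrading

end Data

end MixedHodge

/-! ### Integrating the Lax equation. -/

namespace MixedHodge

namespace Data

variable {V : Type*} [NormedAddCommGroup V] [NormedSpace ℂ V]

/-- The algebra of the operators which preserve the members of `F`. -/
def stabFil (F : Fil V) : Subalgebra ℝ (V →L[ℂ] V) where
  carrier := {a | ∀ p, ∀ v ∈ F p, a v ∈ F p}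
  mul_mem' := fun ha hb p v hv => ha p _ (hb p v hv)
  add_mem' := fun ha hb p v hv => (F p).add_mem (ha p v hv) (hb p v hv)
  algebraMap_mem' := fun c p v hv => by
    rw [Algebra.algebraMap_eq_smul_one]
    exact (F p).smul_mem (c : ℂ) hv

/-- The algebra of the operators which preserve `W` and induce real endomorphisms of all the
quotients `W k / W (k - 2)`. -/
def realAlgebra (D : Data V) : Subalgebra ℝ (V →L[ℂ] V) where
  carrier := {a | (∀ k, ∀ v ∈ D.W k, a v ∈ D.W k) ∧ ∀ k, a ∈ D.real (D.W k) (D.W (k - 2))}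
  mul_mem' := by
    rintro a b ⟨ha, ha'⟩ ⟨hb, hb'⟩
    refine ⟨fun k v hv => ha k _ (hb k v hv), fun k v hv => ?_⟩
    have := (D.W (k - 2)).add_mem (ha' k _ (hb k v hv)) (ha _ _ (hb' k v hv))
    simpa using this
  add_mem' := by
    rintro a b ⟨ha, ha'⟩ ⟨hb, hb'⟩
    exact ⟨fun k v hv => (D.W k).add_mem (ha k v hv) (hb k v hv),
      fun k => Submodule.add_mem _ (ha' k) (hb' k)⟩
  algebraMap_mem' := fun c => by
    rw [Algebra.algebraMap_eq_smul_one]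
    exact ⟨fun k v hv => (D.W k).smul_mem (c : ℂ) hv,
      fun k => Submodule.smul_mem _ c fun v _ => by simp⟩

theorem act_mul (g g' : V →L[ℂ] V) (F : Fil V) : act (g * g') F = act g (act g' F) :=
  funext fun p => Submodule.map_comp (g' : V →ₗ[ℂ] V) (g : V →ₗ[ℂ] V) (F p)

theorem map_unit_eq {g : (V →L[ℂ] V)ˣ} {S : Submodule ℂ V}
    (hg : ∀ v ∈ S, (g : V →L[ℂ] V) v ∈ S)
    (hg' : ∀ v ∈ S, ((g⁻¹ : (V →L[ℂ] V)ˣ) : V →L[ℂ] V) v ∈ S) :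
    S.map ((g : V →L[ℂ] V) : V →ₗ[ℂ] V) = S := by
  refine le_antisymm ?_ fun v hv => ⟨_, hg' v hv, ?_⟩
  · rintro _ ⟨v, hv, rfl⟩
    exact hg v hv
  · exact congrArg (fun f : V →L[ℂ] V => f v) g.mul_inv

theorem act_unit_eq {g : (V →L[ℂ] V)ˣ} {F : Fil V} (hg : (g : V →L[ℂ] V) ∈ stabFil F)
    (hg' : ((g⁻¹ : (V →L[ℂ] V)ˣ) : V →L[ℂ] V) ∈ stabFil F) : act (g : V →L[ℂ] V) F = F :=
  funext fun p => map_unit_eq (hg p) (hg' p)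

theorem one_mem_GC (D : Data V) : (1 : (V →L[ℂ] V)ˣ) ∈ D.GC := by
  refine ⟨fun k => map_unit_eq (fun v hv => hv) fun v hv => by simpa using hv,
    fun k u v u' v' hu hv => ?_⟩
  rw [Subtype.ext (a1 := u') (a2 := u) hu, Subtype.ext (a1 := v') (a2 := v) hv]

variable [FiniteDimensional ℂ V] {D : Data V}

/-- The inverse of a solution of a linear differential equation with coefficient in the Lie algebra
of `H` stays in `H`. -/
theorem inv_fundamental_solution_mem_H {J : Set ℝ} (hJ : IsOpen J) (hJ' : J.OrdConnected)
    {a : ℝ → V →L[ℂ] V} {t₀ : ℝ} (ht₀ : t₀ ∈ J) (ha : ∀ t ∈ J, a t ∈ D.lieGC)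
    {u : ℝ → (V →L[ℂ] V)ˣ} (hu : ∀ t, (u t : V →L[ℂ] V) ∈ D.realAlgebra)
    (hu' : ∀ t, ((u t)⁻¹ : (V →L[ℂ] V)ˣ).val ∈ D.realAlgebra) (h0 : u t₀ = 1)
    (hd : ∀ t ∈ J, HasDerivAt (fun t => (u t : V →L[ℂ] V)) (a t * u t) t) {t : ℝ} (ht : t ∈ J) :
    (u t)⁻¹ ∈ D.H := by
  have hreal := fun k => (hu' t).2 k
  refine ⟨⟨⟨fun k => map_unit_eq ((hu' t).1 k) (by simpa using (hu t).1 k), ?_⟩,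
    fun k v hv => D.W_mono (by lia) (hreal k v hv)⟩, hreal⟩
  intro k v w v' w' hv hw
  obtain ⟨B, hB⟩ := D.exists_form k
  have happ : ∀ z : V, ∀ s ∈ J, HasDerivAt (fun s => (u s : V →L[ℂ] V) z)
      (a s ((u s : V →L[ℂ] V) z)) s := fun z s hs =>
    ((ContinuousLinearMap.apply ℂ V z).restrictScalars ℝ).hasFDerivAt.comp_hasDerivAt s (hd s hs)
  -- The coefficient is an infinitesimal isometry, so the form is constant along the flow of the
  -- fixed vectors v' and w'. At time t these become v and w, and at t₀ they are unchanged.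
  have hconst := eq_of_hasDerivAt_zero hJ hJ'
    (f := fun s => B ((u s : V →L[ℂ] V) v') ((u s : V →L[ℂ] V) w')) (fun s hs => by
      have h1 := (B.bilinearRestrictScalars ℝ).hasDerivAt_of_bilinear
        (fun _ => happ v' s hs) (fun _ => happ w' s hs)
      have hv's := (hu s).1 k v' v'.2
      have hw's := (hu s).1 k w' w'.2
      have h2 := (ha s hs).2 k ⟨_, hv's⟩ ⟨_, hw's⟩ ⟨_, (ha s hs).1 k _ hv's⟩
        ⟨_, (ha s hs).1 k _ hw's⟩ rfl rfl
      rw [← hB, ← hB, add_comm] at h2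
      rw [← h2]
      exact h1) ht ht₀
  have e : ∀ z : V, (u t : V →L[ℂ] V) (((u t)⁻¹ : (V →L[ℂ] V)ˣ).val z) = z := fun z =>
    congrArg (fun f : V →L[ℂ] V => f z) (u t).mul_inv
  simp only [hv, hw, e, h0] at hconst
  rw [← hB, ← hB, hconst, hv, hw]
  rfl

theorem exp_smul_mul_exp_smul_neg (A : V →L[ℂ] V) (t : ℝ) :
    NormedSpace.exp (t • A) * NormedSpace.exp (t • -A) = 1 := by
  have : CompleteSpace (V →L[ℂ] V) := FiniteDimensional.complete ℂ _
  let : NormedAlgebra ℚ (V →L[ℂ] V) := NormedAlgebra.restrictScalars ℚ ℂ _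
  rw [← NormedSpace.exp_add_of_commute
    (((Commute.refl A).neg_right.smul_left t).smul_right t)]
  simp

end Data

end MixedHodge

open MixedHodge MixedHodge.Data in
theorem theorem7p1 {V : Type*} [NormedAddCommGroup V] [NormedSpace ℂ V] [FiniteDimensional ℂ V]
    (D : MixedHodge.Data V) (hn : ℤ → ℤ → ℕ) (F₀ : MixedHodge.Fil V) (hF₀ : F₀ ∈ D.MR hn)
    (J : Set ℝ) (hJ : IsOpen J) (hJ' : J.OrdConnected)
    (β : ℝ → V →L[ℂ] V) (hβ : ∀ y ∈ J, β y ∈ D.lieH)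
    (hLax : ∀ y ∈ J, HasDerivAt β (-⁅β y, D.L F₀ (β y)⁆) y) :
    ∃ (h : ℝ → (V →L[ℂ] V)ˣ) (N : V →L[ℂ] V) (F : MixedHodge.Fil V),
      (∀ y ∈ J, h y ∈ D.H) ∧ N ∈ D.lieH ∧ F ∈ D.Mcheck F₀ ∧
      (∀ y ∈ J, DifferentiableAt ℝ (fun t => (h t : V →L[ℂ] V)) y ∧
        ((h y)⁻¹ : (V →L[ℂ] V)ˣ) * deriv (fun t => (h t : V →L[ℂ] V)) y = -D.L F₀ (β y)) ∧
      (∀ y ∈ J, β y = ((h y)⁻¹ : (V →L[ℂ] V)ˣ) * N * (h y : V →L[ℂ] V)) ∧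
      (∀ y ∈ J, MixedHodge.act (h y : V →L[ℂ] V) F₀ =
        MixedHodge.act (NormedSpace.exp ((Complex.I * (y : ℂ)) • N)) F) := by
  have : FiniteDimensional ℝ (V →L[ℂ] V) := FiniteDimensional.complexToReal _
  have : CompleteSpace (V →L[ℂ] V) := FiniteDimensional.complete ℂ _
  rcases J.eq_empty_or_nonempty with rfl | ⟨y₀, hy₀⟩
  · refine ⟨1, 0, F₀, by simp, D.lieH.zero_mem, ⟨1, D.one_mem_GC, ?_⟩, by simp, by simp, by simp⟩
    exact (act_unit_eq (Subalgebra.one_mem _) (by simp)).symm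
  have hF : D.IsSplit F₀ := { toIsMHS := hF₀.1.1, map_conj_I := hF₀.2 }
  have hQ : D.IsPolarized F₀ := hF₀.1.2.1
  obtain ⟨P, s, hP⟩ := hF.exists_isBigrading
  let a : ℝ → V →L[ℂ] V := fun y => multiplier P s signL (β y)
  have haL : ∀ y ∈ J, D.L F₀ (β y) = a y := fun y hy => hP.L_eq_multiplier hF hQ (hβ y hy).1
  have haH : ∀ y ∈ J, a y ∈ D.lieH := fun y hy => hP.multiplier_signL_mem_lieH hF hQ (hβ y hy)
  have hβc : ContinuousOn β J := fun y hy => (hLax y hy).continuousAt.continuousWithinAt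
  have hac : ContinuousOn a J :=
    (LinearMap.continuous_of_finiteDimensional (multiplier P s signL)).comp_continuousOn hβc
  obtain ⟨u, hu, hu0, hud, hud'⟩ := D.realAlgebra.exists_fundamental_solution hJ hJ' hac
    (fun y hy => ⟨(haH y hy).1.1, (haH y hy).2⟩) hy₀
  set N := β y₀ with hN
  -- The derivative is u⁻¹(β' + [β, Lβ])u, which the Lax equation annihilates.
  have hconst : ∀ y ∈ J, ((u y)⁻¹ : (V →L[ℂ] V)ˣ).val * β y * u y = N := fun y hy => by
    rw [eq_of_hasDerivAt_zero hJ hJ'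
      (f := fun y => ((u y)⁻¹ : (V →L[ℂ] V)ˣ).val * β y * u y) (fun t ht => by
        refine (((hud' t ht).mul (hLax t ht)).mul (hud t ht)).congr_deriv ?_
        simp only [haL t ht, Ring.lie_def, Pi.mul_apply]
        noncomm_ring) hy hy₀]
    simp [hu0, hN]
  have hNu : ∀ y ∈ J, N * ((u y)⁻¹ : (V →L[ℂ] V)ˣ).val = ((u y)⁻¹ : (V →L[ℂ] V)ˣ).val * β y :=
    fun y hy => by rw [← hconst y hy, mul_assoc _ (u y).val, Units.mul_inv, mul_one]
  -- The summand iβ cancels the eigenvalue -i of L on types with r < 0, the only ones that move F₀.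
  let c : ℝ → V →L[ℂ] V := fun y => a y + Complex.I • β y
  have hcF : ∀ y ∈ J, c y ∈ stabFil F₀ := fun y hy p v hv => by
    have e : c y = multiplier P s (signL + Complex.I • 1) (β y) := by
      rw [multiplier_add, multiplier_smul, LinearMap.add_apply, LinearMap.smul_apply,
        hP.multiplier_one]
    rw [e]
    exact hP.multiplier_mem_F hF.antitone (fun r hr => by simp [signL, hr]) (β y) hv
  obtain ⟨x, hx, hx0, hxd, -⟩ := (stabFil F₀).exists_fundamental_solution hJ hJ'
    (hac.add (hβc.const_smul Complex.I)) hcF hy₀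
  set A : V →L[ℂ] V := Complex.I • N with hA
  -- The curve u⁻¹x solves z' = Az, since u⁻¹β = Nu⁻¹; multiplying by exp(-yA) makes it constant.
  have hexp : ∀ y ∈ J, ((u y)⁻¹ : (V →L[ℂ] V)ˣ).val * x y =
      NormedSpace.exp (y • A) * NormedSpace.exp (y₀ • -A) := fun y hy => by
    have h1 := eq_of_hasDerivAt_zero hJ hJ'
      (f := fun y => NormedSpace.exp (y • -A) * (((u y)⁻¹ : (V →L[ℂ] V)ˣ).val * x y))
      (fun t ht => by
        refine ((hasDerivAt_exp_smul_const (𝕂 := ℝ) (-A) t).mul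
          ((hud' t ht).mul (hxd t ht))).congr_deriv ?_
        have e : A * (((u t)⁻¹ : (V →L[ℂ] V)ˣ).val * x t) =
            ((u t)⁻¹ : (V →L[ℂ] V)ˣ).val * ((Complex.I • β t) * x t) := by
          rw [hA, smul_mul_assoc, ← mul_assoc, hNu t ht, smul_mul_assoc, mul_smul_comm, mul_assoc]
        simp only [Pi.mul_apply, Pi.add_apply, Pi.smul_apply]
        rw [mul_assoc, neg_mul, e]
        noncomm_ring) hy hy₀
    simp only [hu0, hx0, inv_one, Units.val_one, mul_one] at h1
    rw [← h1, ← mul_assoc, exp_smul_mul_exp_smul_neg, one_mul]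
  -- g = exp(-iy₀N) moves F₀ to F̃. Membership of N in the complex Lie algebra suffices, as the
  -- orbit is taken under the complex group.
  obtain ⟨g, hg, hge⟩ := (D.mem_lieGC_iff_exp (-A)).1
    (D.lieGC.neg_mem (D.lieGC.smul_mem _ (hβ y₀ hy₀).1)) y₀
  refine ⟨fun y => (u y)⁻¹, N, act (g : V →L[ℂ] V) F₀, fun y hy =>
    inv_fundamental_solution_mem_H hJ hJ' hy₀ (fun t ht => (haH t ht).1) (fun t => (hu t).1)
      (fun t => (hu t).2) hu0 hud hy, hβ y₀ hy₀, ⟨g, hg, rfl⟩, fun y hy => ?_, fun y hy => ?_,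
    fun y hy => ?_⟩
  · refine ⟨(hud' y hy).differentiableAt, ?_⟩
    rw [(hud' y hy).deriv, haL y hy, inv_inv, mul_neg, ← mul_assoc, Units.mul_inv, one_mul]
  · rw [inv_inv, mul_assoc, hNu y hy, ← mul_assoc, Units.mul_inv, one_mul]
  · have e : (Complex.I * (y : ℂ)) • N = y • A := by
      rw [hA, mul_comm, mul_smul, Complex.coe_smul]
    rw [e, ← act_mul, hge, ← hexp y hy, act_mul, act_unit_eq (hx y).1 (hx y).2]
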